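/- Let $A\in\mathbb{C}\setminus\{0\}$ and $q=A^2$. For $n\ge 0$ let $[n]=q^{n-1}+q^{n-3}+\dots+q^{-(n-1)}$ (so $[n]=\frac{q^n-q^{-n}}{q-q^{-1}}$ if $q\neq\pm1$) and $[n]!=[1][2]\cdots[n]$. Spins are elements of $\{0,\frac12,1,\frac32,\dots\}$. A triple of spins $(a,b,c)$ is called $q$-admissible if $a+b+c\in\mathbb{Z}$, $a\le b+c$, $b\le a+c$, $c\le a+b$ and, in case $q^2$ is a root of unity of order $r\ge 2$ (for example $q=e^{i\pi/r}$), $a+b+c\le r-2$. For a $q$-admissible triple put $$\nabla(a,b,c)=\frac{[a+b-c]!\,[a+c-b]!\,[b+c-a]!}{[a+b+c+1]!}.$$ The $q$-$6j$-symbol $\left\{\begin{smallmatrix}a&b&e\\c&d&f\end{smallmatrix}\right\}$ (the value of the tetrahedral network without loop-value factors and with all theta-nets normalized to $1$) is $0$ unless $(a,b,e),(a,d,f),(c,b,f),(c,d,e)$ are $q$-admissible, and then it equals $$\sqrt{\nabla(a,b,e)}\sqrt{\nabla(a,d,f)}\sqrt{\nabla(c,b,f)}\sqrt{\nabla(c,d,e)}\sum_{s}\frac{(-1)^s[s+1]!}{\prod_{i=1}^4[s-t_i]!\,\prod_{k=1}^3[u_k-s]!},$$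 where $t_1=a+b+e$, $t_2=a+d+f$, $t_3=c+b+f$, $t_4=c+d+e$, $u_1=a+b+c+d$, $u_2=b+e+d+f$, $u_3=a+e+c+f$, the sum is over the integers $s$ with $\max_i t_i\le s\le\min_k u_k$, and the square roots are principal ones. Put $\Delta_x=(-1)^{2x}[2x+1]$, and define the toroidal symbol $$\left[\begin{array}{ccc}j_{11}&j_{12}&j_{13}\\j_{21}&j_{22}&j_{23}\\j_{31}&j_{32}&j_{33}\end{array}\right]_A=\sum_x\Delta_x\left\{\begin{array}{ccc}j_{11}&j_{21}&j_{31}\\j_{32}&j_{33}&x\end{array}\right\}\left\{\begin{array}{ccc}j_{12}&j_{22}&j_{32}\\j_{21}&x&j_{23}\end{array}\right\}\left\{\begin{array}{ccc}j_{13}&j_{23}&j_{33}\\x&j_{11}&j_{12}\end{array}\right\}(-1)^{j_{21}+j_{32}-x}A^{2[j_{21}(j_{21}+1)+j_{32}(j_{32}+1)-x(x+1)]},$$ where $x$ runs over the spins (only finitely many terms, all with $(j_{11},j_{33},x)$ $q$-admissible, are non-zero). Then for all spins $j_{11},j_{12},j_{21},j_{22},j_{23},j_{31},j_{32},j_{33},\lambda$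 $$\sum_\mu[2\mu+1]\left[\begin{array}{ccc}j_{11}&j_{12}&\mu\\j_{21}&j_{22}&j_{23}\\j_{31}&j_{32}&j_{33}\end{array}\right]_A\left\{\begin{array}{ccc}j_{11}&j_{12}&\mu\\j_{23}&j_{33}&\lambda\end{array}\right\}=(-1)^{2\lambda}(-1)^{j_{21}+j_{32}-\lambda}A^{2[j_{21}(j_{21}+1)+j_{32}(j_{32}+1)-\lambda(\lambda+1)]}\left\{\begin{array}{ccc}j_{21}&j_{22}&j_{23}\\j_{12}&\lambda&j_{32}\end{array}\right\}\left\{\begin{array}{ccc}j_{31}&j_{32}&j_{33}\\\lambda&j_{11}&j_{21}\end{array}\right\},$$ where $\mu$ runs over the spins for which $(j_{11},j_{12},\mu)$ is $q$-admissible. (A term containing a vanishing $q$-$6j$-symbol is zero, also where its sign or power of $A$ would have a non-integral exponent.) -/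

import Mathlib

open scoped BigOperators

noncomputable section

/-! Spins `j ∈ {0, 1/2, 1, …}` are represented throughout by the natural number `2 j`
(the number of strands of the corresponding edge). -/

/-- The quantum integer `[n] = q^(n-1) + q^(n-3) + ⋯ + q^(-(n-1))`,
that is `(q^n - q^(-n)) / (q - q^(-1))`, with the limiting values at `q = 1` and `q = -1`. -/
def qInt (q : ℂ) (n : ℕ) : ℂ :=
  ∑ k ∈ Finset.range n, q ^ ((n : ℤ) - 1 - 2 * (k : ℤ))

theorem qInt_one (n : ℕ) : qInt 1 n = n := by
  simp [qInt]

theorem qInt_eq_div (q : ℂ) (hq : q ≠ 0) (hq2 : q - q⁻¹ ≠ 0) (n : ℕ) :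
    qInt q n = (q ^ (n : ℤ) - q ^ (-(n : ℤ))) / (q - q⁻¹) := by
  rw [eq_div_iff hq2, qInt, Finset.sum_mul]
  have h : ∀ k ∈ Finset.range n, q ^ ((n : ℤ) - 1 - 2 * (k : ℤ)) * (q - q⁻¹)
      = q ^ ((n : ℤ) - 2 * (k : ℤ)) - q ^ ((n : ℤ) - 2 * ((k + 1 : ℕ) : ℤ)) := by
    intro k _
    rw [mul_sub, ← zpow_add_one₀ hq, ← zpow_sub_one₀ hq]
    congr 2
    · ring
    · push_cast; ring
  rw [Finset.sum_congr rfl h,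
    Finset.sum_range_sub' (fun k : ℕ => q ^ ((n : ℤ) - 2 * (k : ℤ)))]
  congr 2
  ring_nf

/-- The quantum factorial `[n]! = [1] [2] ⋯ [n]`. -/
def qFact (q : ℂ) (n : ℕ) : ℂ :=
  ∏ k ∈ Finset.range n, qInt q (k + 1)

/-- `q`-admissible triples of labels: the parity condition, the triangle inequalities and,
when `q ^ 2` is a root of unity of order `r ≥ 2` (for instance `q = exp (i π / r)`),
the bound `a + b + c ≤ 2 r - 4`. For `q = 1`, `q = -1` and for `q` not a root of unity
(where `orderOf (q ^ 2)` is `1`, `1` and `0`) the last condition is void. -/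
def QAdmissible (q : ℂ) (a b c : ℕ) : Prop :=
  Even (a + b + c) ∧ (a ≤ b + c ∧ b ≤ a + c ∧ c ≤ a + b) ∧
    (2 ≤ orderOf (q ^ 2) → a + b + c + 4 ≤ 2 * orderOf (q ^ 2))

theorem qAdmissible_exp_iff (r : ℕ) (hr : 2 ≤ r) (a b c : ℕ) :
    QAdmissible (Complex.exp (Real.pi * Complex.I / r)) a b c ↔
      Even (a + b + c) ∧ (a ≤ b + c ∧ b ≤ a + c ∧ c ≤ a + b) ∧ a + b + c + 4 ≤ 2 * r := by
  have h : orderOf (Complex.exp (Real.pi * Complex.I / r) ^ 2) = r := by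
    rw [← Complex.exp_nat_mul]
    have h2 := (Complex.isPrimitiveRoot_exp r (by omega)).eq_orderOf
    rw [show ((2 : ℕ) : ℂ) * (Real.pi * Complex.I / r) = 2 * Real.pi * Complex.I / r by
      push_cast; ring]
    exact h2.symm
  simp [QAdmissible, h, hr]

open Classical in
/-- The finite set of the labels `c` such that `(a, b, c)` is `q`-admissible. -/
def qCouplings (q : ℂ) (a b : ℕ) : Finset ℕ :=
  (Finset.range (a + b + 1)).filter (fun c => QAdmissible q a b c)

open Classical in
theorem mem_qCouplings (q : ℂ) (a b c : ℕ) :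
    c ∈ qCouplings q a b ↔ QAdmissible q a b c := by
  rw [qCouplings, Finset.mem_filter, Finset.mem_range]
  refine ⟨fun h => h.2, fun h => ⟨?_, h⟩⟩
  have := h.2.1.2.2
  omega

/-- The (squared) triangle coefficient of the triple of spins `(a/2, b/2, c/2)`,
`[(a+b-c)/2]! [(a+c-b)/2]! [(b+c-a)/2]! / [(a+b+c)/2 + 1]!`. -/
def qTriangle (q : ℂ) (a b c : ℕ) : ℂ :=
  qFact q ((a + b - c) / 2) * qFact q ((a + c - b) / 2) * qFact q ((b + c - a) / 2)
    / qFact q ((a + b + c) / 2 + 1)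

/-- The sum in the quantum Racah formula for the labels `{a b e; c d f}`. -/
def qRacahSum (q : ℂ) (a b e c d f : ℕ) : ℂ :=
  let t₁ := (a + b + e) / 2
  let t₂ := (a + d + f) / 2
  let t₃ := (c + b + f) / 2
  let t₄ := (c + d + e) / 2
  let u₁ := (a + b + c + d) / 2
  let u₂ := (b + e + d + f) / 2
  let u₃ := (a + e + c + f) / 2
  ∑ s ∈ Finset.Icc (max (max t₁ t₂) (max t₃ t₄)) (min u₁ (min u₂ u₃)),
    (-1 : ℂ) ^ s * qFact q (s + 1) /
      (qFact q (s - t₁) * qFact q (s - t₂) * qFact q (s - t₃) * qFact q (s - t₄)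
        * (qFact q (u₁ - s) * qFact q (u₂ - s) * qFact q (u₃ - s)))

open Classical in
/-- The (Racah-Wigner) `q`-`6j`-symbol `{a b e; c d f}`: the evaluation of the tetrahedral
network normalized so that all theta-nets have the value one and without loop-value factors.
It is zero unless its four triples are `q`-admissible. The square roots are principal ones;
for `q > 0` and for `q = exp (i π / r)` their arguments are positive reals. -/
def qSixJ (q : ℂ) (a b e c d f : ℕ) : ℂ :=
  if QAdmissible q a b e ∧ QAdmissible q a d f ∧ QAdmissible q c b f ∧ QAdmissible q c d e then
    (qTriangle q a b e) ^ (1 / 2 : ℂ) * (qTriangle q a d f) ^ (1 / 2 : ℂ)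
      * (qTriangle q c b f) ^ (1 / 2 : ℂ) * (qTriangle q c d e) ^ (1 / 2 : ℂ)
      * qRacahSum q a b e c d f
  else 0

/-- The loop value `(-1)^(2j) [2j+1]` of an edge of spin `j = x / 2`. -/
def loopValue (q : ℂ) (x : ℕ) : ℂ := (-1) ^ x * qInt q (x + 1)

/-- The twist factor `(-1)^(i+j-k) A^(2 (i(i+1) + j(j+1) - k(k+1)))` of the vertex with spins
`i = a/2, j = b/2, k = x/2`. Both exponents are integers if `a + b + x` is even. -/
def twistFactor (A : ℂ) (a b x : ℕ) : ℂ :=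
  (-1 : ℂ) ^ (((a : ℤ) + b - x) / 2)
    * A ^ (((a : ℤ) * (a + 2) + b * (b + 2) - x * (x + 2)) / 2)

/-- The toroidal symbol `[j₁₁ j₁₂ j₁₃; j₂₁ j₂₂ j₂₃; j₃₁ j₃₂ j₃₃]_A`, with `q = A ^ 2`.
All the other labels `x` contribute zero. -/
def toroidalSymbol (A : ℂ) (j₁₁ j₁₂ j₁₃ j₂₁ j₂₂ j₂₃ j₃₁ j₃₂ j₃₃ : ℕ) : ℂ :=
  ∑ x ∈ qCouplings (A ^ 2) j₁₁ j₃₃,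
    loopValue (A ^ 2) x
      * qSixJ (A ^ 2) j₁₁ j₂₁ j₃₁ j₃₂ j₃₃ x
      * qSixJ (A ^ 2) j₁₂ j₂₂ j₃₂ j₂₁ x j₂₃
      * qSixJ (A ^ 2) j₁₃ j₂₃ j₃₃ x j₁₁ j₁₂
      * twistFactor A j₂₁ j₃₂ x

end

/-! The toroidal symbol depends on `μ` only through the symbol containing `j₁₃`. Expanding it,
exchanging the sums over `μ` and `x`, and rearranging that symbol by tetrahedral symmetry leaves a
sum over `μ` which is the orthogonality relation of the `q`-`6j`-symbols: it vanishes unless `x = λ`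
and then equals `1 / [2λ+1]`. This cancels the quantum integer of the loop value, leaving the sign
`(-1)^(2λ)`, the twist factor at `λ` and two symbols.

Orthogonality is proved from the Racah formula, for every `q ≠ 0`, roots of unity included. Racah
sums with outer labels `(a, b)` are linked to those with `(a - 1, b ∓ 1)` by three-term relations
(`sixJSum_lower`, `sixJSum_raise`, `sixJSum_mixed`), each obtained by telescoping in the summation
variable. Relations for opposite shifts are adjoint for the pairing weighted by triangle
coefficients. So orthogonality for the shifted outer labels gives a recurrence in `f` for the
pairing of columns `g` and `f`, and the expected value satisfies the same recurrence
(`racahPairing_recurrence`). Its leading coefficient is nonzero on admissible labels, so everything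
reduces by induction to the column `g = f = 0`, where the claim is the dimension count `∑ [e+1] =
[a+1] [b+1]`, truncated at roots of unity. -/

noncomputable section

/-! ### Quantum integers at integer arguments -/

/-- The quantum integer `[n]` for an integer `n`. -/
def qNum (q : ℂ) (n : ℤ) : ℂ :=
  if 0 ≤ n then qInt q n.toNat else -qInt q (-n).toNat

/-- The inverse quantum factorial `1 / [n]!`, zero for negative `n`. -/
def qInvFact (q : ℂ) (n : ℤ) : ℂ :=
  if 0 ≤ n then (qFact q n.toNat)⁻¹ else 0

theorem qNum_natCast (q : ℂ) (n : ℕ) : qNum q n = qInt q n := by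
  simp [qNum]

theorem qNum_generic {q : ℂ} (hq : q ≠ 0) (hq2 : q ^ 2 ≠ 1) (n : ℤ) :
    qNum q n = (q ^ n - (q ^ n)⁻¹) / (q - q⁻¹) := by
  have h : q - q⁻¹ ≠ 0 := by
    intro h
    apply hq2
    rw [sub_eq_zero] at h
    rw [sq]
    nth_rewrite 2 [h]
    exact mul_inv_cancel₀ hq
  unfold qNum
  split_ifs with hn
  · rw [qInt_eq_div q hq h, Int.toNat_of_nonneg hn, zpow_neg]
  · rw [qInt_eq_div q hq h, Int.toNat_of_nonneg (by omega), neg_neg, zpow_neg, ← neg_div]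
    ring

theorem continuousOn_qInt (n : ℕ) : ContinuousOn (fun q : ℂ => qInt q n) {0}ᶜ := by
  unfold qInt
  refine continuousOn_finsetSum _ fun k _ => ?_
  intro x hx
  exact (continuousAt_zpow₀ x _ (Or.inl hx)).continuousWithinAt

@[fun_prop]
theorem continuousOn_qNum (n : ℤ) : ContinuousOn (fun q : ℂ => qNum q n) {0}ᶜ := by
  unfold qNum
  split_ifs
  · exact continuousOn_qInt _
  · exact (continuousOn_qInt _).neg

/-- An identity between functions of `q` continuous away from zero may be checked at `q ^ 2 ≠ 1`. -/
theorem eq_of_generic {f g : ℂ → ℂ} (hf : ContinuousOn f {0}ᶜ) (hg : ContinuousOn g {0}ᶜ)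
    (h : ∀ q : ℂ, q ≠ 0 → q ^ 2 ≠ 1 → f q = g q) :
    ∀ q : ℂ, q ≠ 0 → f q = g q := by
  intro q hq
  have hopen : IsOpen ({0}ᶜ : Set ℂ) := isOpen_compl_singleton
  have hmem : ({0}ᶜ : Set ℂ) ∈ nhds q := hopen.mem_nhds hq
  have hcf : ContinuousAt (fun x => f x - g x) q :=
    (hf.continuousAt hmem).sub (hg.continuousAt hmem)
  have hfin : Set.Finite ({1, -1} : Set ℂ) := by simp
  -- The excluded values `1` and `-1` are isolated, so the difference vanishes on a punctured
  -- neighbourhood of `q` and hence in the limit.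
  have hev : ∀ᶠ x in nhdsWithin q {q}ᶜ, f x - g x = 0 := by
    have h1 : ∀ᶠ x in nhdsWithin q {q}ᶜ, x ∈ ({0}ᶜ : Set ℂ) := nhdsWithin_le_nhds hmem
    have h2 : ∀ᶠ x in nhdsWithin q {q}ᶜ, x ∉ ({1, -1} : Set ℂ) := by
      have hf2 : Set.Finite (({1, -1} : Set ℂ) \ {q}) := hfin.subset Set.sdiff_subset
      have : (({1, -1} : Set ℂ) \ {q})ᶜ ∈ nhds q :=
        hf2.isClosed.isOpen_compl.mem_nhds (by simp)
      filter_upwards [nhdsWithin_le_nhds this, self_mem_nhdsWithin] with x hx hx2 hx3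
      exact hx ⟨hx3, hx2⟩
    filter_upwards [h1, h2] with x hx1 hx2
    rw [h x hx1 (fun h3 => hx2 (by simpa using h3)), sub_self]
  have hlim : Filter.Tendsto (fun x => f x - g x) (nhdsWithin q {q}ᶜ) (nhds (f q - g q)) :=
    hcf.tendsto.mono_left nhdsWithin_le_nhds
  have hlim0 : Filter.Tendsto (fun x => f x - g x) (nhdsWithin q {q}ᶜ) (nhds 0) :=
    tendsto_const_nhds.congr' (by filter_upwards [hev] with x hx; exact hx.symm)
  exact sub_eq_zero.mp (tendsto_nhds_unique hlim hlim0)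

theorem qNum_zero (q : ℂ) : qNum q 0 = 0 := by simp [qNum, qInt]

theorem qNum_one (q : ℂ) : qNum q 1 = 1 := by simp [qNum, qInt]

/-- Serves twice: as the telescoping step in `sum_range_qNum`, and, when `[r] = 0`, as the
reflection `[r-x] [r-y] = [x] [y]` behind the truncated dimension count. -/
theorem qNum_sub_mul_qNum_sub (q : ℂ) (hq : q ≠ 0) (r x y : ℤ) :
    qNum q (r - x) * qNum q (r - y) = qNum q x * qNum q y + qNum q r * qNum q (r - x - y) := by
  revert q
  refine eq_of_generic (by fun_prop) (by fun_prop) ?_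
  intro q hq hq2
  simp only [qNum_generic hq hq2, zpow_sub₀ hq]
  have h0 : ∀ m : ℤ, q ^ m ≠ 0 := fun m => zpow_ne_zero _ hq
  have h1 := h0 r
  have h2 := h0 x
  have h3 := h0 y
  generalize q ^ r = r at *
  generalize q ^ x = x at *
  generalize q ^ y = y at *
  simp only [div_eq_mul_inv, mul_inv, inv_inv]
  -- Both sides are homogeneous in the common denominator, so it may be treated as a free variable.
  generalize (q - q⁻¹)⁻¹ = d
  field_simp
  ring

/-! ### Telescoping certificates -/

/-- What remains of the telescoping identity in `racahSum_lower` after division by the common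
factorials. The right side is the difference of two consecutive values of the telescoping function.
The two certificates below play the same role for `racahSum_raise` and `racahSum_mixed`. -/
theorem qNum_certificate_lower (q : ℂ) (hq : q ≠ 0) (s t₁ t₂ t₃ t₄ u₁ u₂ u₃ : ℤ)
    (h : t₁ + t₂ + t₃ + t₄ = u₁ + u₂ + u₃) :
    qNum q (u₁ - t₄) * qNum q (u₂ + u₃ - t₁ - t₄ + 1) * (qNum q (s + 1) * qNum q (s + 1 - t₁))
      - qNum q (t₂ + 1) * qNum q (t₃ + 1) * (qNum q (s - t₄) * qNum q (s + 1 - t₁))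
      - qNum q (u₂ - t₁ + 1) * qNum q (u₃ - t₁ + 1) * (qNum q (u₁ - s) * qNum q (s + 1))
      = -(qNum q (u₁ - s) * qNum q (u₂ - s) * qNum q (u₃ - s) * qNum q (s + 1)
          + qNum q (s - t₂) * qNum q (s - t₃) * qNum q (s - t₄) * qNum q (s + 1 - t₁)) := by
  obtain rfl : u₃ = t₁ + t₂ + t₃ + t₄ - u₁ - u₂ := by omega
  revert q
  refine eq_of_generic (by fun_prop) (by fun_prop) ?_
  intro q hq hq2
  simp only [qNum_generic hq hq2, zpow_add₀ hq, zpow_sub₀ hq, zpow_one]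
  have h0 : ∀ m : ℤ, q ^ m ≠ 0 := fun m => zpow_ne_zero _ hq
  have hs := h0 s
  have h1 := h0 t₁
  have h2 := h0 t₂
  have h3 := h0 t₃
  have h4 := h0 t₄
  have h5 := h0 u₁
  have h6 := h0 u₂
  generalize q ^ s = s at *
  generalize q ^ t₁ = t₁ at *
  generalize q ^ t₂ = t₂ at *
  generalize q ^ t₃ = t₃ at *
  generalize q ^ t₄ = t₄ at *
  generalize q ^ u₁ = u₁ at *
  generalize q ^ u₂ = u₂ at *
  simp only [div_eq_mul_inv, mul_inv, inv_inv]
  generalize (q - q⁻¹)⁻¹ = d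
  field_simp
  ring

theorem qNum_certificate_raise (q : ℂ) (hq : q ≠ 0) (s t₁ t₂ t₃ t₄ u₁ u₂ u₃ : ℤ)
    (h : t₁ + t₂ + t₃ + t₄ = u₁ + u₂ + u₃) :
    qNum q (t₁ + 2) * qNum q (u₂ + u₃ - t₁ - t₄ + 1) * (qNum q (s + 1 - t₄) * qNum q (u₁ + 1 - s))
      - qNum q (u₂ - t₄ + 1) * qNum q (u₃ - t₄ + 1) * (qNum q (s + 2) * qNum q (u₁ + 1 - s))
      - qNum q (u₁ + 1 - t₂) * qNum q (u₁ + 1 - t₃) * (qNum q (s - t₁) * qNum q (s + 1 - t₄))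
      = -(qNum q (s + 2) * qNum q (u₂ - s) * qNum q (u₃ - s) * qNum q (u₁ + 1 - s)
          + qNum q (s - t₁) * qNum q (s - t₂) * qNum q (s - t₃) * qNum q (s + 1 - t₄)) := by
  obtain rfl : u₃ = t₁ + t₂ + t₃ + t₄ - u₁ - u₂ := by omega
  revert q
  refine eq_of_generic (by fun_prop) (by fun_prop) ?_
  intro q hq hq2
  simp only [qNum_generic hq hq2, zpow_add₀ hq, zpow_sub₀ hq, zpow_ofNat]
  have h0 : ∀ m : ℤ, q ^ m ≠ 0 := fun m => zpow_ne_zero _ hq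
  have hs := h0 s
  have h1 := h0 t₁
  have h2 := h0 t₂
  have h3 := h0 t₃
  have h4 := h0 t₄
  have h5 := h0 u₁
  have h6 := h0 u₂
  generalize q ^ s = s at *
  generalize q ^ t₁ = t₁ at *
  generalize q ^ t₂ = t₂ at *
  generalize q ^ t₃ = t₃ at *
  generalize q ^ t₄ = t₄ at *
  generalize q ^ u₁ = u₁ at *
  generalize q ^ u₂ = u₂ at *
  simp only [div_eq_mul_inv, mul_inv, inv_inv]
  generalize (q - q⁻¹)⁻¹ = d
  field_simp
  ring

theorem qNum_certificate_mixed (q : ℂ) (hq : q ≠ 0) (s t₁ t₂ t₃ t₄ u₁ u₂ u₃ : ℤ)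
    (h : t₁ + t₂ + t₃ + t₄ = u₁ + u₂ + u₃) :
    qNum q (u₃ - t₃) * qNum q (u₂ + u₃ - t₁ - t₄ + 1) * (qNum q (u₂ + 1 - s) * qNum q (s + 1 - t₂))
      - qNum q (u₂ + 1 - t₁) * qNum q (u₂ + 1 - t₄) * (qNum q (s - t₃) * qNum q (s + 1 - t₂))
      - qNum q (t₂ + 1) * qNum q (u₁ - t₂ + 1) * (qNum q (u₃ - s) * qNum q (u₂ + 1 - s))
      = -(qNum q (s + 2) * qNum q (u₁ - s) * qNum q (u₃ - s) * qNum q (u₂ + 1 - s)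
          + qNum q (s - t₁) * qNum q (s - t₃) * qNum q (s - t₄) * qNum q (s + 1 - t₂)) := by
  obtain rfl : u₃ = t₁ + t₂ + t₃ + t₄ - u₁ - u₂ := by omega
  revert q
  refine eq_of_generic (by fun_prop) (by fun_prop) ?_
  intro q hq hq2
  simp only [qNum_generic hq hq2, zpow_add₀ hq, zpow_sub₀ hq, zpow_ofNat]
  have h0 : ∀ m : ℤ, q ^ m ≠ 0 := fun m => zpow_ne_zero _ hq
  have hs := h0 s
  have h1 := h0 t₁
  have h2 := h0 t₂
  have h3 := h0 t₃
  have h4 := h0 t₄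
  have h5 := h0 u₁
  have h6 := h0 u₂
  generalize q ^ s = s at *
  generalize q ^ t₁ = t₁ at *
  generalize q ^ t₂ = t₂ at *
  generalize q ^ t₃ = t₃ at *
  generalize q ^ t₄ = t₄ at *
  generalize q ^ u₁ = u₁ at *
  generalize q ^ u₂ = u₂ at *
  simp only [div_eq_mul_inv, mul_inv, inv_inv]
  generalize (q - q⁻¹)⁻¹ = d
  field_simp
  ring

/-! ### Quantum factorials and their inverses -/

theorem qFact_succ (q : ℂ) (n : ℕ) : qFact q (n + 1) = qInt q (n + 1) * qFact q n := by
  rw [qFact, Finset.prod_range_succ, mul_comm]; rfl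

theorem qFact_ne_zero_of_le {q : ℂ} {m n : ℕ} (h : m ≤ n) (hn : qFact q n ≠ 0) :
    qFact q m ≠ 0 := by
  rw [qFact, Finset.prod_ne_zero_iff] at *
  exact fun k hk => hn k (by simp at *; omega)

theorem qInt_ne_zero_of_le {q : ℂ} {m n : ℕ} (h0 : 0 < m) (h : m ≤ n) (hn : qFact q n ≠ 0) :
    qInt q m ≠ 0 := by
  rw [qFact, Finset.prod_ne_zero_iff] at hn
  have := hn (m - 1) (by simp; omega)
  rwa [Nat.sub_add_cancel h0] at this

theorem qNum_ne_zero_of_le {q : ℂ} {m : ℤ} {n : ℕ} (h0 : 0 < m) (h : m ≤ n)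
    (hn : qFact q n ≠ 0) : qNum q m ≠ 0 := by
  lift m to ℕ using h0.le
  rw [qNum_natCast]
  exact qInt_ne_zero_of_le (by omega) (by omega) hn

theorem qInvFact_of_neg (q : ℂ) {n : ℤ} (h : n < 0) : qInvFact q n = 0 := by
  simp [qInvFact, h.not_ge]

theorem qInvFact_natCast (q : ℂ) (n : ℕ) : qInvFact q n = (qFact q n)⁻¹ := by
  simp [qInvFact]

/-- For `n ≤ 0` both sides vanish. For `n > 0` the bound by `m` guarantees `[n] ≠ 0`, which could
fail at a root of unity. -/
theorem qInvFact_sub_one {q : ℂ} {n : ℤ} {m : ℕ} (hm : qFact q m ≠ 0) (h : n ≤ m) :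
    qInvFact q (n - 1) = qNum q n * qInvFact q n := by
  rcases lt_trichotomy n 0 with h0 | h0 | h0
  · rw [qInvFact_of_neg q h0, qInvFact_of_neg q (by omega), mul_zero]
  · subst h0
    rw [qNum_zero, zero_mul, qInvFact_of_neg q (by omega)]
  · lift n to ℕ using h0.le
    obtain ⟨k, rfl⟩ : ∃ k, n = k + 1 := ⟨n - 1, by omega⟩
    have h1 := qInt_ne_zero_of_le (m := k + 1) (by omega) (by omega) hm
    rw [show ((k + 1 : ℕ) : ℤ) - 1 = (k : ℤ) by push_cast; ring, qInvFact_natCast,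
      qInvFact_natCast, qNum_natCast, qFact_succ, mul_inv, ← mul_assoc, mul_inv_cancel₀ h1,
      one_mul]

/-! ### Three-term relations for the Racah sum -/

/-- A summand of the quantum Racah formula. -/
def racahTerm (q : ℂ) (t₁ t₂ t₃ t₄ u₁ u₂ u₃ : ℤ) (s : ℕ) : ℂ :=
  (-1) ^ s * qFact q (s + 1)
    * (qInvFact q (s - t₁) * qInvFact q (s - t₂) * qInvFact q (s - t₃) * qInvFact q (s - t₄))
    * (qInvFact q (u₁ - s) * qInvFact q (u₂ - s) * qInvFact q (u₃ - s))

/-- The sum in the quantum Racah formula, as a function of the triangle sums `tᵢ` and the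
quadrangle sums `uₖ`. -/
def racahSum (q : ℂ) (t₁ t₂ t₃ t₄ u₁ u₂ u₃ : ℤ) : ℂ :=
  ∑ s ∈ Finset.range (u₁.toNat + 1), racahTerm q t₁ t₂ t₃ t₄ u₁ u₂ u₃ s

theorem racahSum_eq_sum_range (q : ℂ) (t₁ t₂ t₃ t₄ u₁ u₂ u₃ : ℤ) {N : ℕ} (hN : u₁ < N) :
    racahSum q t₁ t₂ t₃ t₄ u₁ u₂ u₃
      = ∑ s ∈ Finset.range N, racahTerm q t₁ t₂ t₃ t₄ u₁ u₂ u₃ s := by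
  have key : ∀ K M : ℕ, K ≤ M → u₁ < K →
      ∑ s ∈ Finset.range K, racahTerm q t₁ t₂ t₃ t₄ u₁ u₂ u₃ s
      = ∑ s ∈ Finset.range M, racahTerm q t₁ t₂ t₃ t₄ u₁ u₂ u₃ s := by
    intro K M hKM hK
    refine Finset.sum_subset (by simpa using hKM) fun s _ hs => ?_
    rw [Finset.mem_range] at hs
    rw [racahTerm, qInvFact_of_neg q (n := u₁ - s) (by omega)]
    ring
  rw [racahSum, key (u₁.toNat + 1) (max N (u₁.toNat + 1)) (by omega) (by omega),
    key N (max N (u₁.toNat + 1)) (by omega) (by omega)]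

theorem racahSum_swap (q : ℂ) (t₁ t₂ t₃ t₄ u₁ u₂ u₃ : ℤ) :
    racahSum q t₁ t₃ t₂ t₄ u₁ u₃ u₂ = racahSum q t₁ t₂ t₃ t₄ u₁ u₂ u₃ := by
  refine Finset.sum_congr rfl fun s _ => ?_
  simp only [racahTerm]
  ring

theorem racahSum_flip (q : ℂ) (t₁ t₂ t₃ t₄ u₁ u₂ u₃ : ℤ) :
    racahSum q t₄ t₃ t₂ t₁ u₁ u₂ u₃ = racahSum q t₁ t₂ t₃ t₄ u₁ u₂ u₃ := by
  refine Finset.sum_congr rfl fun s _ => ?_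
  simp only [racahTerm]
  ring

theorem sum_range_eq_zero_of_telescope {f G : ℕ → ℂ} {N : ℕ} (h : ∀ s, f s = G (s + 1) - G s)
    (h0 : G 0 = 0) (hN : G N = 0) : ∑ s ∈ Finset.range N, f s = 0 := by
  rw [Finset.sum_congr rfl fun s _ => h s, Finset.sum_range_sub, h0, hN, sub_zero]

/-- The summands of the combination are the differences of an explicit function `G` of `s` that
vanishes at both ends. The bounds by `m` keep every factorial that gets cancelled nonzero. -/
theorem racahSum_lower {q : ℂ} (hq : q ≠ 0) {t₁ t₂ t₃ t₄ u₁ u₂ u₃ : ℤ} {m : ℕ}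
    (h : t₁ + t₂ + t₃ + t₄ = u₁ + u₂ + u₃) (hm : qFact q m ≠ 0)
    (ht : 0 ≤ t₄) (h21 : u₂ - t₁ + 1 ≤ m) (h31 : u₃ - t₁ + 1 ≤ m) (h13 : u₁ - t₃ ≤ m)
    (h12 : u₁ - t₂ ≤ m) (h24 : u₂ - t₄ ≤ m) :
    qNum q (u₁ - t₄) * qNum q (u₂ + u₃ - t₁ - t₄ + 1) * racahSum q t₁ t₂ t₃ t₄ u₁ u₂ u₃
      + qNum q (t₂ + 1) * qNum q (t₃ + 1)
        * racahSum q (t₁ - 1) (t₂ - 1) (t₃ - 1) t₄ (u₁ - 1) (u₂ - 1) (u₃ - 1)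
      - qNum q (u₂ - t₁ + 1) * qNum q (u₃ - t₁ + 1)
        * racahSum q (t₁ - 1) t₂ t₃ t₄ (u₁ - 1) u₂ u₃ = 0 := by
  set N := u₁.toNat + 1 with hN
  -- The sum with nearly all parameters lowered is reindexed by one step, which flips the sign `(-1)
  -- ^ s`. The new term at `s = 0` vanishes because `t₄ ≥ 0`.
  have hshift : racahSum q (t₁ - 1) (t₂ - 1) (t₃ - 1) t₄ (u₁ - 1) (u₂ - 1) (u₃ - 1)
      = ∑ s ∈ Finset.range N, -((-1) ^ s * qFact q s
        * (qInvFact q (s - t₁) * qInvFact q (s - t₂) * qInvFact q (s - t₃)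
          * qInvFact q (s - t₄ - 1))
        * (qInvFact q (u₁ - s) * qInvFact q (u₂ - s) * qInvFact q (u₃ - s))) := by
    rw [racahSum_eq_sum_range q _ _ _ _ _ _ _ (N := u₁.toNat) (by omega), hN,
      Finset.sum_range_succ']
    rw [qInvFact_of_neg q (n := ((0 : ℕ) : ℤ) - t₄ - 1) (by omega)]
    simp only [mul_zero, zero_mul, neg_zero, add_zero]
    refine Finset.sum_congr rfl fun s _ => ?_
    rw [racahTerm]
    push_cast
    rw [show (s : ℤ) - (t₁ - 1) = s + 1 - t₁ by ring, show (s : ℤ) - (t₂ - 1) = s + 1 - t₂ by ring,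
      show (s : ℤ) - (t₃ - 1) = s + 1 - t₃ by ring, show (s : ℤ) + 1 - t₄ - 1 = s - t₄ by ring,
      show u₁ - 1 - (s : ℤ) = u₁ - (s + 1) by ring, show u₂ - 1 - (s : ℤ) = u₂ - (s + 1) by ring,
      show u₃ - 1 - (s : ℤ) = u₃ - (s + 1) by ring]
    ring
  rw [hshift, racahSum_eq_sum_range q _ _ _ _ _ _ _ (N := N) (by omega),
    racahSum_eq_sum_range q _ _ _ _ _ _ _ (N := N) (by omega), Finset.mul_sum, Finset.mul_sum,
    Finset.mul_sum, ← Finset.sum_add_distrib, ← Finset.sum_sub_distrib]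
  refine sum_range_eq_zero_of_telescope (G := fun s : ℕ => (-1) ^ s * qFact q s
        * (qInvFact q (s - t₁) * qInvFact q (s - t₂ - 1) * qInvFact q (s - t₃ - 1)
          * qInvFact q (s - t₄ - 1))
        * (qInvFact q (u₁ - s) * qInvFact q (u₂ - s) * qInvFact q (u₃ - s))) ?_ ?_ ?_
  · intro s
    have e1 : ((s + 1 : ℕ) : ℤ) - t₁ = s + 1 - t₁ := by push_cast; ring
    have e2 : ((s + 1 : ℕ) : ℤ) - t₂ - 1 = s - t₂ := by push_cast; ring
    have e3 : ((s + 1 : ℕ) : ℤ) - t₃ - 1 = s - t₃ := by push_cast; ring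
    have e4 : ((s + 1 : ℕ) : ℤ) - t₄ - 1 = s - t₄ := by push_cast; ring
    have e5 : u₁ - ((s + 1 : ℕ) : ℤ) = u₁ - s - 1 := by push_cast; ring
    have e6 : u₂ - ((s + 1 : ℕ) : ℤ) = u₂ - s - 1 := by push_cast; ring
    have e7 : u₃ - ((s + 1 : ℕ) : ℤ) = u₃ - s - 1 := by push_cast; ring
    have e8 : (s : ℤ) - (t₁ - 1) = s + 1 - t₁ := by ring
    have e9 : u₁ - 1 - (s : ℤ) = u₁ - s - 1 := by ring
    have e10 : (s : ℤ) - t₁ = s + 1 - t₁ - 1 := by ring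
    simp only [racahTerm, e1, e2, e3, e4, e5, e6, e7, e8, e9]
    rw [e10]
    have hneg : ∀ n : ℤ, n < 0 → qInvFact q n = 0 ∧ qInvFact q (n - 1) = 0 := fun n hn =>
      ⟨qInvFact_of_neg q hn, qInvFact_of_neg q (by omega)⟩
    -- If one of the seven arguments is negative, every term contains a vanishing inverse factorial.
    -- Otherwise all the terms are multiples of one product of inverse factorials.
    rcases lt_or_ge ((s : ℤ) + 1 - t₁) 0 with k1 | k1
    · simp [hneg _ k1]
    rcases lt_or_ge ((s : ℤ) - t₂) 0 with k2 | k2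
    · simp [hneg _ k2]
    rcases lt_or_ge ((s : ℤ) - t₃) 0 with k3 | k3
    · simp [hneg _ k3]
    rcases lt_or_ge ((s : ℤ) - t₄) 0 with k4 | k4
    · simp [hneg _ k4]
    rcases lt_or_ge (u₁ - (s : ℤ)) 0 with k5 | k5
    · simp [hneg _ k5]
    rcases lt_or_ge (u₂ - (s : ℤ)) 0 with k6 | k6
    · simp [hneg _ k6]
    rcases lt_or_ge (u₃ - (s : ℤ)) 0 with k7 | k7
    · simp [hneg _ k7]
    rw [qInvFact_sub_one (n := s + 1 - t₁) hm (by omega),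
      qInvFact_sub_one (n := s - t₂) hm (by omega), qInvFact_sub_one (n := s - t₃) hm (by omega),
      qInvFact_sub_one (n := s - t₄) hm (by omega), qInvFact_sub_one (n := u₁ - s) hm (by omega),
      qInvFact_sub_one (n := u₂ - s) hm (by omega), qInvFact_sub_one (n := u₃ - s) hm (by omega),
      qFact_succ, ← qNum_natCast]
    have key := qNum_certificate_lower q hq s t₁ t₂ t₃ t₄ u₁ u₂ u₃ h
    push_cast
    linear_combination ((-1) ^ s * qFact q s
        * (qInvFact q (s + 1 - t₁) * qInvFact q (s - t₂) * qInvFact q (s - t₃)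
          * qInvFact q (s - t₄))
        * (qInvFact q (u₁ - s) * qInvFact q (u₂ - s) * qInvFact q (u₃ - s))) * key
  · rw [qInvFact_of_neg q (n := ((0 : ℕ) : ℤ) - t₄ - 1) (by omega)]
    ring
  · rw [qInvFact_of_neg q (n := u₁ - (N : ℤ)) (by omega)]
    ring

/-- Telescoping again, with the shift of `racahSum_lower` reversed. The upper limit is one larger
because `u₁ + 1` occurs. -/
theorem racahSum_raise {q : ℂ} (hq : q ≠ 0) {t₁ t₂ t₃ t₄ u₁ u₂ u₃ : ℤ} {m : ℕ}
    (h : t₁ + t₂ + t₃ + t₄ = u₁ + u₂ + u₃) (hm : qFact q m ≠ 0)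
    (ht : 0 ≤ t₁) (h12 : u₁ + 1 - t₂ ≤ m) (h13 : u₁ + 1 - t₃ ≤ m) (h24 : u₂ + 1 - t₄ ≤ m)
    (h34 : u₃ + 1 - t₄ ≤ m) (h21 : u₂ - t₁ ≤ m) :
    qNum q (t₁ + 2) * qNum q (u₂ + u₃ - t₁ - t₄ + 1) * racahSum q t₁ t₂ t₃ t₄ u₁ u₂ u₃
      + qNum q (u₂ - t₄ + 1) * qNum q (u₃ - t₄ + 1)
        * racahSum q (t₁ + 1) (t₂ + 1) (t₃ + 1) t₄ (u₁ + 1) (u₂ + 1) (u₃ + 1)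
      - qNum q (u₁ + 1 - t₂) * qNum q (u₁ + 1 - t₃)
        * racahSum q (t₁ + 1) t₂ t₃ t₄ (u₁ + 1) u₂ u₃ = 0 := by
  set N := u₁.toNat + 2 with hN
  have hshift : racahSum q (t₁ + 1) (t₂ + 1) (t₃ + 1) t₄ (u₁ + 1) (u₂ + 1) (u₃ + 1)
      = ∑ s ∈ Finset.range N, -((-1) ^ s * qFact q (s + 1 + 1)
        * (qInvFact q (s - t₁) * qInvFact q (s - t₂) * qInvFact q (s - t₃)
          * qInvFact q (s + 1 - t₄))
        * (qInvFact q (u₁ - s) * qInvFact q (u₂ - s) * qInvFact q (u₃ - s))) := by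
    rw [racahSum_eq_sum_range q _ _ _ _ _ _ _ (N := N + 1) (by omega), Finset.sum_range_succ',
      show racahTerm q (t₁ + 1) (t₂ + 1) (t₃ + 1) t₄ (u₁ + 1) (u₂ + 1) (u₃ + 1) 0 = 0 by
        rw [racahTerm, qInvFact_of_neg q (n := ((0 : ℕ) : ℤ) - (t₁ + 1)) (by omega)]; ring,
      add_zero]
    refine Finset.sum_congr rfl fun s _ => ?_
    rw [racahTerm]
    push_cast
    rw [show (s : ℤ) + 1 - (t₁ + 1) = s - t₁ by ring, show (s : ℤ) + 1 - (t₂ + 1) = s - t₂ by ring,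
      show (s : ℤ) + 1 - (t₃ + 1) = s - t₃ by ring,
      show u₁ + 1 - ((s : ℤ) + 1) = u₁ - s by ring, show u₂ + 1 - ((s : ℤ) + 1) = u₂ - s by ring,
      show u₃ + 1 - ((s : ℤ) + 1) = u₃ - s by ring]
    ring
  rw [hshift, racahSum_eq_sum_range q _ _ _ _ _ _ _ (N := N) (by omega),
    racahSum_eq_sum_range q _ _ _ _ _ _ _ (N := N) (by omega), Finset.mul_sum, Finset.mul_sum,
    Finset.mul_sum, ← Finset.sum_add_distrib, ← Finset.sum_sub_distrib]
  refine sum_range_eq_zero_of_telescope (G := fun s : ℕ => (-1) ^ s * qFact q (s + 1)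
        * (qInvFact q (s - t₁ - 1) * qInvFact q (s - t₂ - 1) * qInvFact q (s - t₃ - 1)
          * qInvFact q (s - t₄))
        * (qInvFact q (u₁ + 1 - s) * qInvFact q (u₂ - s) * qInvFact q (u₃ - s))) ?_ ?_ ?_
  · intro s
    have e1 : ((s + 1 : ℕ) : ℤ) - t₁ - 1 = s - t₁ := by push_cast; ring
    have e2 : ((s + 1 : ℕ) : ℤ) - t₂ - 1 = s - t₂ := by push_cast; ring
    have e3 : ((s + 1 : ℕ) : ℤ) - t₃ - 1 = s - t₃ := by push_cast; ring
    have e4 : ((s + 1 : ℕ) : ℤ) - t₄ = s + 1 - t₄ := by push_cast; ring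
    have e5 : u₁ + 1 - ((s + 1 : ℕ) : ℤ) = u₁ + 1 - s - 1 := by push_cast; ring
    have e6 : u₂ - ((s + 1 : ℕ) : ℤ) = u₂ - s - 1 := by push_cast; ring
    have e7 : u₃ - ((s + 1 : ℕ) : ℤ) = u₃ - s - 1 := by push_cast; ring
    have e8 : (s : ℤ) - (t₁ + 1) = s - t₁ - 1 := by ring
    have e9 : u₁ - (s : ℤ) = u₁ + 1 - s - 1 := by ring
    have e10 : (s : ℤ) - t₄ = s + 1 - t₄ - 1 := by ring
    simp only [racahTerm, e1, e2, e3, e4, e5, e6, e7, e8, e9]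
    rw [e10]
    have hneg : ∀ n : ℤ, n < 0 → qInvFact q n = 0 ∧ qInvFact q (n - 1) = 0 := fun n hn =>
      ⟨qInvFact_of_neg q hn, qInvFact_of_neg q (by omega)⟩
    rcases lt_or_ge ((s : ℤ) - t₁) 0 with k1 | k1
    · simp [hneg _ k1]
    rcases lt_or_ge ((s : ℤ) - t₂) 0 with k2 | k2
    · simp [hneg _ k2]
    rcases lt_or_ge ((s : ℤ) - t₃) 0 with k3 | k3
    · simp [hneg _ k3]
    rcases lt_or_ge ((s : ℤ) + 1 - t₄) 0 with k4 | k4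
    · simp [hneg _ k4]
    rcases lt_or_ge (u₁ + 1 - (s : ℤ)) 0 with k5 | k5
    · simp [hneg _ k5]
    rcases lt_or_ge (u₂ - (s : ℤ)) 0 with k6 | k6
    · simp [hneg _ k6]
    rcases lt_or_ge (u₃ - (s : ℤ)) 0 with k7 | k7
    · simp [hneg _ k7]
    rw [qInvFact_sub_one (n := (s : ℤ) - t₁) hm (by omega),
      qInvFact_sub_one (n := (s : ℤ) - t₂) hm (by omega),
      qInvFact_sub_one (n := (s : ℤ) - t₃) hm (by omega),
      qInvFact_sub_one (n := (s : ℤ) + 1 - t₄) hm (by omega),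
      qInvFact_sub_one (n := u₁ + 1 - (s : ℤ)) hm (by omega),
      qInvFact_sub_one (n := u₂ - (s : ℤ)) hm (by omega),
      qInvFact_sub_one (n := u₃ - (s : ℤ)) hm (by omega),
      qFact_succ q (s + 1), ← qNum_natCast]
    have key := qNum_certificate_raise q hq s t₁ t₂ t₃ t₄ u₁ u₂ u₃ h
    push_cast
    rw [show (s : ℤ) + 1 + 1 = s + 2 by ring]
    linear_combination ((-1) ^ s * qFact q (s + 1)
        * (qInvFact q (s - t₁) * qInvFact q (s - t₂) * qInvFact q (s - t₃)
          * qInvFact q (s + 1 - t₄))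
        * (qInvFact q (u₁ + 1 - s) * qInvFact q (u₂ - s) * qInvFact q (u₃ - s))) * key
  · rw [qInvFact_of_neg q (n := ((0 : ℕ) : ℤ) - t₁ - 1) (by omega)]
    ring
  · rw [qInvFact_of_neg q (n := u₁ + 1 - (N : ℤ)) (by omega)]
    ring

/-- Telescoping without reindexing, since the three sums have the same `t₁`, `t₄` and `u₁`. -/
theorem racahSum_mixed {q : ℂ} (hq : q ≠ 0) {t₁ t₂ t₃ t₄ u₁ u₂ u₃ : ℤ} {m : ℕ}
    (h : t₁ + t₂ + t₃ + t₄ = u₁ + u₂ + u₃) (hm : qFact q m ≠ 0)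
    (ht : 0 ≤ t₁) (h12 : u₁ - t₂ + 1 ≤ m) (h21 : u₂ + 1 - t₁ ≤ m) (h24 : u₂ + 1 - t₄ ≤ m)
    (h13 : u₁ - t₃ ≤ m) (h34 : u₃ - t₄ ≤ m) :
    qNum q (u₃ - t₃) * qNum q (u₂ + u₃ - t₁ - t₄ + 1) * racahSum q t₁ t₂ t₃ t₄ u₁ u₂ u₃
      - qNum q (u₂ + 1 - t₁) * qNum q (u₂ + 1 - t₄)
        * racahSum q t₁ t₂ (t₃ + 1) t₄ u₁ (u₂ + 1) u₃
      - qNum q (t₂ + 1) * qNum q (u₁ - t₂ + 1)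
        * racahSum q t₁ (t₂ - 1) t₃ t₄ u₁ u₂ (u₃ - 1) = 0 := by
  set N := u₁.toNat + 1 with hN
  rw [racahSum_eq_sum_range q _ _ _ _ _ _ _ (N := N) (by omega),
    racahSum_eq_sum_range q _ _ _ _ _ _ _ (N := N) (by omega),
    racahSum_eq_sum_range q _ _ _ _ _ _ _ (N := N) (by omega), Finset.mul_sum, Finset.mul_sum,
    Finset.mul_sum, ← Finset.sum_sub_distrib, ← Finset.sum_sub_distrib]
  refine sum_range_eq_zero_of_telescope (G := fun s : ℕ => (-1) ^ s * qFact q (s + 1)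
        * (qInvFact q (s - t₁ - 1) * qInvFact q (s - t₂) * qInvFact q (s - t₃ - 1)
          * qInvFact q (s - t₄ - 1))
        * (qInvFact q (u₁ - s) * qInvFact q (u₂ + 1 - s) * qInvFact q (u₃ - s))) ?_ ?_ ?_
  · intro s
    have e1 : ((s + 1 : ℕ) : ℤ) - t₁ - 1 = s - t₁ := by push_cast; ring
    have e2 : ((s + 1 : ℕ) : ℤ) - t₂ = s + 1 - t₂ := by push_cast; ring
    have e3 : ((s + 1 : ℕ) : ℤ) - t₃ - 1 = s - t₃ := by push_cast; ring
    have e4 : ((s + 1 : ℕ) : ℤ) - t₄ - 1 = s - t₄ := by push_cast; ring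
    have e5 : u₁ - ((s + 1 : ℕ) : ℤ) = u₁ - s - 1 := by push_cast; ring
    have e6 : u₂ + 1 - ((s + 1 : ℕ) : ℤ) = u₂ + 1 - s - 1 := by push_cast; ring
    have e7 : u₃ - ((s + 1 : ℕ) : ℤ) = u₃ - s - 1 := by push_cast; ring
    have e8 : (s : ℤ) - (t₂ - 1) = s + 1 - t₂ := by ring
    have e9 : (s : ℤ) - (t₃ + 1) = s - t₃ - 1 := by ring
    have e10 : u₃ - 1 - (s : ℤ) = u₃ - s - 1 := by ring
    have e11 : u₂ - (s : ℤ) = u₂ + 1 - s - 1 := by ring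
    have e12 : (s : ℤ) - t₂ = s + 1 - t₂ - 1 := by ring
    simp only [racahTerm, e1, e2, e3, e4, e5, e6, e7, e8, e9, e10, e11]
    rw [e12]
    have hneg : ∀ n : ℤ, n < 0 → qInvFact q n = 0 ∧ qInvFact q (n - 1) = 0 := fun n hn =>
      ⟨qInvFact_of_neg q hn, qInvFact_of_neg q (by omega)⟩
    rcases lt_or_ge ((s : ℤ) - t₁) 0 with k1 | k1
    · simp [hneg _ k1]
    rcases lt_or_ge ((s : ℤ) + 1 - t₂) 0 with k2 | k2
    · simp [hneg _ k2]
    rcases lt_or_ge ((s : ℤ) - t₃) 0 with k3 | k3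
    · simp [hneg _ k3]
    rcases lt_or_ge ((s : ℤ) - t₄) 0 with k4 | k4
    · simp [hneg _ k4]
    rcases lt_or_ge (u₁ - (s : ℤ)) 0 with k5 | k5
    · simp [hneg _ k5]
    rcases lt_or_ge (u₂ + 1 - (s : ℤ)) 0 with k6 | k6
    · simp [hneg _ k6]
    rcases lt_or_ge (u₃ - (s : ℤ)) 0 with k7 | k7
    · simp [hneg _ k7]
    rw [qInvFact_sub_one (n := (s : ℤ) - t₁) hm (by omega),
      qInvFact_sub_one (n := (s : ℤ) + 1 - t₂) hm (by omega),
      qInvFact_sub_one (n := (s : ℤ) - t₃) hm (by omega),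
      qInvFact_sub_one (n := (s : ℤ) - t₄) hm (by omega),
      qInvFact_sub_one (n := u₁ - (s : ℤ)) hm (by omega),
      qInvFact_sub_one (n := u₂ + 1 - (s : ℤ)) hm (by omega),
      qInvFact_sub_one (n := u₃ - (s : ℤ)) hm (by omega),
      qFact_succ q (s + 1), ← qNum_natCast]
    have key := qNum_certificate_mixed q hq s t₁ t₂ t₃ t₄ u₁ u₂ u₃ h
    push_cast
    rw [show (s : ℤ) + 1 + 1 = s + 2 by ring]
    linear_combination ((-1) ^ s * qFact q (s + 1)
        * (qInvFact q (s - t₁) * qInvFact q (s + 1 - t₂) * qInvFact q (s - t₃)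
          * qInvFact q (s - t₄))
        * (qInvFact q (u₁ - s) * qInvFact q (u₂ + 1 - s) * qInvFact q (u₃ - s))) * key
  · rw [qInvFact_of_neg q (n := ((0 : ℕ) : ℤ) - t₁ - 1) (by omega)]
    ring
  · rw [qInvFact_of_neg q (n := u₁ - (N : ℤ)) (by omega)]
    ring

theorem racahTerm_ne_zero {q : ℂ} {t₁ t₂ t₃ t₄ u₁ u₂ u₃ : ℤ} {s : ℕ}
    (h : racahTerm q t₁ t₂ t₃ t₄ u₁ u₂ u₃ s ≠ 0) :
    qFact q (s + 1) ≠ 0 ∧ (t₁ ≤ s ∧ t₂ ≤ s ∧ t₃ ≤ s ∧ t₄ ≤ s) ∧ s ≤ u₁ ∧ s ≤ u₂ ∧ s ≤ u₃ := by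
  have hneg : ∀ n : ℤ, qInvFact q n ≠ 0 → 0 ≤ n := fun n hn =>
    not_lt.mp fun h0 => hn (qInvFact_of_neg q h0)
  simp only [racahTerm, mul_ne_zero_iff] at h
  obtain ⟨⟨⟨-, hf⟩, ⟨⟨h1, h2⟩, h3⟩, h4⟩, ⟨h5, h6⟩, h7⟩ := h
  have := hneg _ h1
  have := hneg _ h2
  have := hneg _ h3
  have := hneg _ h4
  have := hneg _ h5
  have := hneg _ h6
  have := hneg _ h7
  refine ⟨hf, ?_, ?_⟩ <;> omega

/-! ### Admissible integer labels and triangle coefficients -/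

/-- `q`-admissibility of integer labels, expressed by the quantum factorials. -/
def QAdm (q : ℂ) (a b c : ℤ) : Prop :=
  2 ∣ a + b + c ∧ (a ≤ b + c ∧ b ≤ a + c ∧ c ≤ a + b) ∧ qFact q ((a + b + c) / 2 + 1).toNat ≠ 0

theorem QAdm.rotate {q : ℂ} {a b c : ℤ} (h : QAdm q a b c) : QAdm q b c a := by
  obtain ⟨h1, h2, h3⟩ := h
  refine ⟨by omega, by omega, ?_⟩
  rwa [show b + c + a = a + b + c by ring]

theorem QAdm.swap {q : ℂ} {a b c : ℤ} (h : QAdm q a b c) : QAdm q b a c := by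
  obtain ⟨h1, h2, h3⟩ := h
  refine ⟨by omega, by omega, ?_⟩
  rwa [show b + a + c = a + b + c by ring]

/-- The squared triangle coefficient for integer labels. -/
def triangleCoeff (q : ℂ) (a b c : ℤ) : ℂ :=
  qFact q ((a + b - c) / 2).toNat * qFact q ((a + c - b) / 2).toNat
    * qFact q ((b + c - a) / 2).toNat / qFact q ((a + b + c) / 2 + 1).toNat

theorem triangleCoeff_swap (q : ℂ) (a b c : ℤ) : triangleCoeff q a b c = triangleCoeff q b a c := by
  rw [triangleCoeff, triangleCoeff, add_comm b a]
  ring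

theorem triangleCoeff_rotate (q : ℂ) (a b c : ℤ) :
    triangleCoeff q a b c = triangleCoeff q b c a := by
  rw [triangleCoeff, triangleCoeff, add_comm b a, add_comm c a, show b + c + a = a + b + c by ring]
  ring

theorem QAdm.triangleCoeff_ne_zero {q : ℂ} {a b c : ℤ} (h : QAdm q a b c) :
    triangleCoeff q a b c ≠ 0 := by
  obtain ⟨h1, h2, h3⟩ := h
  refine div_ne_zero (mul_ne_zero (mul_ne_zero ?_ ?_) ?_) h3 <;>
    exact qFact_ne_zero_of_le (by omega) h3

theorem QAdm.qNum_ne_zero {q : ℂ} {a b c n : ℤ} (h : QAdm q a b c) (h0 : 0 < n)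
    (hn : n ≤ (a + b + c) / 2 + 1) : qNum q n ≠ 0 :=
  qNum_ne_zero_of_le h0 (by omega) h.2.2

theorem qFact_toNat (q : ℂ) {n : ℤ} (h : 0 < n) :
    qFact q n.toNat = qNum q n * qFact q (n - 1).toNat := by
  lift n to ℕ using h.le
  obtain ⟨k, rfl⟩ : ∃ k, n = k + 1 := ⟨n - 1, by omega⟩
  rw [qNum_natCast, Int.toNat_natCast, qFact_succ, show (((k + 1 : ℕ) : ℤ) - 1).toNat = k by omega]

theorem triangleCoeff_lower {q : ℂ} {a b e : ℤ} (h : QAdm q a b e) (h' : QAdm q (a - 1) (b - 1) e) :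
    triangleCoeff q a b e * qNum q ((a + b + e) / 2 + 1)
      = triangleCoeff q (a - 1) (b - 1) e * qNum q ((a + b - e) / 2) := by
  obtain ⟨h1, h2, h3⟩ := h
  obtain ⟨h1', h2', h3'⟩ := h'
  have hn := qNum_ne_zero_of_le (m := (a + b + e) / 2 + 1) (by omega) (by omega) h3
  rw [triangleCoeff, triangleCoeff, qFact_toNat q (n := (a + b + e) / 2 + 1) (by omega),
    qFact_toNat q (n := (a + b - e) / 2) (by omega),
    show (a - 1 + (b - 1) - e) / 2 = (a + b - e) / 2 - 1 by omega,
    show (a - 1 + e - (b - 1)) = a + e - b by ring, show (b - 1 + e - (a - 1)) = b + e - a by ring,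
    show (a - 1 + (b - 1) + e) / 2 + 1 = (a + b + e) / 2 + 1 - 1 by omega]
  rw [show (a - 1 + (b - 1) + e) / 2 + 1 = (a + b + e) / 2 + 1 - 1 by omega] at h3'
  field_simp

theorem triangleCoeff_mixed {q : ℂ} {a b e : ℤ} (h : QAdm q a b e) (h' : QAdm q (a - 1) (b + 1) e) :
    triangleCoeff q a b e * qNum q ((b + e - a) / 2 + 1)
      = triangleCoeff q (a - 1) (b + 1) e * qNum q ((a + e - b) / 2) := by
  obtain ⟨h1, h2, h3⟩ := h
  obtain ⟨h1', h2', h3'⟩ := h'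
  rw [triangleCoeff, triangleCoeff, show a - 1 + (b + 1) = a + b by ring,
    show (b + 1 + e - (a - 1)) / 2 = (b + e - a) / 2 + 1 by omega,
    show (a - 1 + e - (b + 1)) / 2 = (a + e - b) / 2 - 1 by omega,
    qFact_toNat q (n := (a + e - b) / 2) (by omega),
    qFact_toNat q (n := (b + e - a) / 2 + 1) (by omega), add_sub_cancel_right]
  field_simp

/-! ### Racah sums as functions of six labels -/

/-- The Racah sum for the integer labels `{a b e; c d f}`. -/
def sixJSum (q : ℂ) (a b c d e f : ℤ) : ℂ :=
  racahSum q ((a + b + e) / 2) ((a + d + f) / 2) ((c + b + f) / 2) ((c + d + e) / 2)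
    ((a + b + c + d) / 2) ((b + e + d + f) / 2) ((a + e + c + f) / 2)

theorem sixJSum_swap (q : ℂ) (a b c d e f : ℤ) :
    sixJSum q b a d c e f = sixJSum q a b c d e f := by
  rw [sixJSum, sixJSum, racahSum_swap]
  congr 2 <;> ring

theorem sixJSum_flip (q : ℂ) (a b c d e f : ℤ) :
    sixJSum q c d a b e f = sixJSum q a b c d e f := by
  rw [sixJSum, sixJSum, racahSum_flip]
  congr 2 <;> ring

/-- A nonzero summand needs `tᵢ ≤ s ≤ uₖ` and `[s+1]! ≠ 0`. The differences `uₖ - tᵢ` give all the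
triangle inequalities, and `tᵢ ≤ s` gives the root-of-unity bound. Thus Racah sums vanish by
themselves off the admissible range. -/
theorem qAdm_of_sixJSum_ne_zero {q : ℂ} {a b c d e f : ℤ} (h1 : 2 ∣ a + b + e) (h2 : 2 ∣ a + d + f)
    (h3 : 2 ∣ c + b + f) (h4 : 2 ∣ c + d + e) (h : sixJSum q a b c d e f ≠ 0) :
    QAdm q a b e ∧ QAdm q a d f ∧ QAdm q c b f ∧ QAdm q c d e := by
  rw [sixJSum, racahSum] at h
  obtain ⟨s, -, hs⟩ := Finset.exists_ne_zero_of_sum_ne_zero h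
  obtain ⟨hf, h5, h6⟩ := racahTerm_ne_zero hs
  have hF : ∀ n : ℤ, n ≤ s → qFact q (n + 1).toNat ≠ 0 := fun n hn =>
    qFact_ne_zero_of_le (by omega) hf
  refine ⟨⟨h1, ?_, hF _ (by omega)⟩, ⟨h2, ?_, hF _ (by omega)⟩, ⟨h3, ?_, hF _ (by omega)⟩,
    ⟨h4, ?_, hF _ (by omega)⟩⟩ <;> omega

theorem exists_qFact_ne_zero {q : ℂ} {a b c d f : ℤ} (h : QAdm q a d f) (h' : QAdm q c b f) :
    ∃ m : ℕ, qFact q m ≠ 0 ∧ (a + d + f) / 2 + 1 ≤ m ∧ (c + b + f) / 2 + 1 ≤ m := by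
  rcases le_total ((a + d + f) / 2) ((c + b + f) / 2) with hle | hle
  · exact ⟨_, h'.2.2, by omega, by omega⟩
  · exact ⟨_, h.2.2, by omega, by omega⟩

/-- Only the factor `[(a+b-e)/2]` on the left involves `e`. The coefficients on the right do not, so
the relation can be summed over `e`. The next two relations have the same shape. -/
theorem sixJSum_lower {q : ℂ} (hq : q ≠ 0) {a b c d e f : ℤ} (h : QAdm q a d f)
    (h' : QAdm q c b f) (he : 2 ∣ c + d + e) (he0 : 0 ≤ e) :
    qNum q (f + 1) * (qNum q ((a + b - e) / 2) * sixJSum q a b c d e f)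
      = -(qNum q ((a + d + f) / 2 + 1) * qNum q ((c + b + f) / 2 + 1))
          * sixJSum q (a - 1) (b - 1) c d e (f - 1)
        + qNum q ((d + f - a) / 2 + 1) * qNum q ((c + f - b) / 2 + 1)
          * sixJSum q (a - 1) (b - 1) c d e (f + 1) := by
  obtain ⟨m, hm, hm1, hm2⟩ := exists_qFact_ne_zero h h'
  obtain ⟨h1, h2, -⟩ := h
  obtain ⟨h3, h4, -⟩ := h'
  have key := racahSum_lower hq (t₁ := (a + b + e) / 2) (t₂ := (a + d + f) / 2)
    (t₃ := (c + b + f) / 2) (t₄ := (c + d + e) / 2) (u₁ := (a + b + c + d) / 2)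
    (u₂ := (b + e + d + f) / 2) (u₃ := (a + e + c + f) / 2) (m := m) (by omega) hm (by omega)
    (by omega) (by omega) (by omega) (by omega) (by omega)
  rw [show (a + b + c + d) / 2 - (c + d + e) / 2 = (a + b - e) / 2 by omega,
    show (b + e + d + f) / 2 + (a + e + c + f) / 2 - (a + b + e) / 2 - (c + d + e) / 2 + 1
      = f + 1 by omega,
    show (b + e + d + f) / 2 - (a + b + e) / 2 = (d + f - a) / 2 by omega,
    show (a + e + c + f) / 2 - (a + b + e) / 2 = (c + f - b) / 2 by omega] at key
  simp only [sixJSum]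
  rw [show (a - 1 + (b - 1) + e) / 2 = (a + b + e) / 2 - 1 by omega,
    show (a - 1 + d + (f - 1)) / 2 = (a + d + f) / 2 - 1 by omega,
    show (c + (b - 1) + (f - 1)) / 2 = (c + b + f) / 2 - 1 by omega,
    show (a - 1 + (b - 1) + c + d) / 2 = (a + b + c + d) / 2 - 1 by omega,
    show (b - 1 + e + d + (f - 1)) / 2 = (b + e + d + f) / 2 - 1 by omega,
    show (a - 1 + e + c + (f - 1)) / 2 = (a + e + c + f) / 2 - 1 by omega,
    show (a - 1 + d + (f + 1)) / 2 = (a + d + f) / 2 by omega,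
    show (c + (b - 1) + (f + 1)) / 2 = (c + b + f) / 2 by omega,
    show (b - 1 + e + d + (f + 1)) / 2 = (b + e + d + f) / 2 by omega,
    show (a - 1 + e + c + (f + 1)) / 2 = (a + e + c + f) / 2 by omega]
  linear_combination key

theorem sixJSum_raise {q : ℂ} (hq : q ≠ 0) {a b c d e f : ℤ} (h : QAdm q (a - 1) d (f - 1))
    (h' : QAdm q c (b - 1) (f - 1)) (hab : 2 ∣ a + b + e) (hab0 : 0 ≤ a + b + e - 2) :
    qNum q f * (qNum q ((a + b + e) / 2 + 1) * sixJSum q (a - 1) (b - 1) c d e (f - 1))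
      = -(qNum q ((b + f - c) / 2) * qNum q ((a + f - d) / 2)) * sixJSum q a b c d e f
        + qNum q ((b + c - f) / 2 + 1) * qNum q ((a + d - f) / 2 + 1)
          * sixJSum q a b c d e (f - 2) := by
  obtain ⟨m, hm, hm1, hm2⟩ := exists_qFact_ne_zero h h'
  obtain ⟨h1, h2, -⟩ := h
  obtain ⟨h3, h4, -⟩ := h'
  have key := racahSum_raise hq (t₁ := (a + b + e) / 2 - 1) (t₂ := (a + d + f) / 2 - 1)
    (t₃ := (c + b + f) / 2 - 1) (t₄ := (c + d + e) / 2) (u₁ := (a + b + c + d) / 2 - 1)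
    (u₂ := (b + e + d + f) / 2 - 1) (u₃ := (a + e + c + f) / 2 - 1) (m := m) (by omega) hm
    (by omega) (by omega) (by omega) (by omega) (by omega) (by omega)
  rw [show (a + b + e) / 2 - 1 + 2 = (a + b + e) / 2 + 1 by omega,
    show (b + e + d + f) / 2 - 1 + ((a + e + c + f) / 2 - 1) - ((a + b + e) / 2 - 1)
      - (c + d + e) / 2 + 1 = f by omega,
    show (b + e + d + f) / 2 - 1 - (c + d + e) / 2 + 1 = (b + f - c) / 2 by omega,
    show (a + e + c + f) / 2 - 1 - (c + d + e) / 2 + 1 = (a + f - d) / 2 by omega,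
    show (a + b + c + d) / 2 - 1 + 1 - ((a + d + f) / 2 - 1) = (b + c - f) / 2 + 1 by omega,
    show (a + b + c + d) / 2 - 1 + 1 - ((c + b + f) / 2 - 1) = (a + d - f) / 2 + 1 by omega] at key
  simp only [sub_add_cancel] at key
  simp only [sixJSum]
  rw [show (a - 1 + (b - 1) + e) / 2 = (a + b + e) / 2 - 1 by omega,
    show (a - 1 + d + (f - 1)) / 2 = (a + d + f) / 2 - 1 by omega,
    show (c + (b - 1) + (f - 1)) / 2 = (c + b + f) / 2 - 1 by omega,
    show (a - 1 + (b - 1) + c + d) / 2 = (a + b + c + d) / 2 - 1 by omega,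
    show (b - 1 + e + d + (f - 1)) / 2 = (b + e + d + f) / 2 - 1 by omega,
    show (a - 1 + e + c + (f - 1)) / 2 = (a + e + c + f) / 2 - 1 by omega,
    show (a + d + (f - 2)) / 2 = (a + d + f) / 2 - 1 by omega,
    show (c + b + (f - 2)) / 2 = (c + b + f) / 2 - 1 by omega,
    show (b + e + d + (f - 2)) / 2 = (b + e + d + f) / 2 - 1 by omega,
    show (a + e + c + (f - 2)) / 2 = (a + e + c + f) / 2 - 1 by omega]
  linear_combination key

theorem sixJSum_mixed {q : ℂ} (hq : q ≠ 0) {a b c d e f : ℤ} (h : QAdm q a d f)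
    (h' : QAdm q c b f) (he : 2 ∣ c + d + e) (hab0 : 0 ≤ a + b + e) :
    qNum q (f + 1) * (qNum q ((a + e - b) / 2) * sixJSum q a b c d e f)
      = qNum q ((a + d + f) / 2 + 1) * qNum q ((b + c - f) / 2 + 1)
          * sixJSum q (a - 1) (b + 1) c d e (f - 1)
        + qNum q ((d + f - a) / 2 + 1) * qNum q ((b + f - c) / 2 + 1)
          * sixJSum q (a - 1) (b + 1) c d e (f + 1) := by
  obtain ⟨m, hm, hm1, hm2⟩ := exists_qFact_ne_zero h h'
  obtain ⟨h1, h2, -⟩ := h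
  obtain ⟨h3, h4, -⟩ := h'
  have key := racahSum_mixed hq (t₁ := (a + b + e) / 2) (t₂ := (a + d + f) / 2)
    (t₃ := (c + b + f) / 2) (t₄ := (c + d + e) / 2) (u₁ := (a + b + c + d) / 2)
    (u₂ := (b + e + d + f) / 2) (u₃ := (a + e + c + f) / 2) (m := m) (by omega) hm (by omega)
    (by omega) (by omega) (by omega) (by omega) (by omega)
  rw [show (a + e + c + f) / 2 - (c + b + f) / 2 = (a + e - b) / 2 by omega,
    show (b + e + d + f) / 2 + (a + e + c + f) / 2 - (a + b + e) / 2 - (c + d + e) / 2 + 1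
      = f + 1 by omega,
    show (b + e + d + f) / 2 + 1 - (a + b + e) / 2 = (d + f - a) / 2 + 1 by omega,
    show (b + e + d + f) / 2 + 1 - (c + d + e) / 2 = (b + f - c) / 2 + 1 by omega,
    show (a + b + c + d) / 2 - (a + d + f) / 2 + 1 = (b + c - f) / 2 + 1 by omega] at key
  simp only [sixJSum]
  rw [show (a - 1 + (b + 1) + e) / 2 = (a + b + e) / 2 by omega,
    show (a - 1 + d + (f - 1)) / 2 = (a + d + f) / 2 - 1 by omega,
    show (c + (b + 1) + (f - 1)) / 2 = (c + b + f) / 2 by omega,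
    show (a - 1 + (b + 1) + c + d) / 2 = (a + b + c + d) / 2 by omega,
    show (b + 1 + e + d + (f - 1)) / 2 = (b + e + d + f) / 2 by omega,
    show (a - 1 + e + c + (f - 1)) / 2 = (a + e + c + f) / 2 - 1 by omega,
    show (a - 1 + d + (f + 1)) / 2 = (a + d + f) / 2 by omega,
    show (c + (b + 1) + (f + 1)) / 2 = (c + b + f) / 2 + 1 by omega,
    show (b + 1 + e + d + (f + 1)) / 2 = (b + e + d + f) / 2 + 1 by omega,
    show (a - 1 + e + c + (f + 1)) / 2 = (a + e + c + f) / 2 by omega]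
  linear_combination key

/-! ### The pairing of columns and its expected value -/

instance (q : ℂ) (a b c : ℤ) : Decidable (QAdm q a b c) := Classical.propDecidable _

/-- The labels coupling both with `a, b` and with `c, d`. -/
def commonCouplings (q : ℂ) (a b c d : ℤ) : Finset ℤ :=
  Finset.filter (fun e : ℤ => QAdm q a b e ∧ QAdm q c d e) (Finset.Icc 0 (a + b))

theorem mem_commonCouplings {q : ℂ} {a b c d e : ℤ} :
    e ∈ commonCouplings q a b c d ↔ QAdm q a b e ∧ QAdm q c d e := by
  rw [commonCouplings, Finset.mem_filter, Finset.mem_Icc]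
  refine ⟨fun h => h.2, fun h => ⟨?_, h⟩⟩
  have := h.1.2.1
  omega

/-- The scalar product of two columns of the matrix of Racah sums. -/
def racahPairing (q : ℂ) (a b c d g f : ℤ) : ℂ :=
  ∑ e ∈ commonCouplings q a b c d, qNum q (e + 1) * triangleCoeff q a b e * triangleCoeff q c d e
    * sixJSum q a b c d e g * sixJSum q a b c d e f

/-- The expected value of `racahPairing`. -/
def racahNorm (q : ℂ) (a b c d g f : ℤ) : ℂ :=
  if g = f ∧ QAdm q a d f ∧ QAdm q c b f then
    (qNum q (f + 1) * triangleCoeff q a d f * triangleCoeff q c b f)⁻¹ else 0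

/-- Orthogonality of the Racah sums with outer labels `a, b, c, d`. -/
def RacahOrthogonal (q : ℂ) (a b c d : ℤ) : Prop :=
  ∀ g f : ℤ, 2 ∣ a + d + g → 2 ∣ c + b + g → 2 ∣ a + d + f → 2 ∣ c + b + f →
    racahPairing q a b c d g f = racahNorm q a b c d g f

theorem racahPairing_comm (q : ℂ) (a b c d g f : ℤ) :
    racahPairing q a b c d g f = racahPairing q a b c d f g :=
  Finset.sum_congr rfl fun e _ => by ring

theorem racahNorm_comm (q : ℂ) (a b c d g f : ℤ) :
    racahNorm q a b c d g f = racahNorm q a b c d f g := by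
  rcases eq_or_ne g f with rfl | h
  · rfl
  · rw [racahNorm, racahNorm, if_neg (fun h' => h h'.1), if_neg (fun h' => h h'.1.symm)]

theorem racahPairing_eq_zero {q : ℂ} {a b c d g f : ℤ} (h1 : 2 ∣ a + d + f) (h2 : 2 ∣ c + b + f)
    (h : ¬(QAdm q a d f ∧ QAdm q c b f)) : racahPairing q a b c d g f = 0 := by
  refine Finset.sum_eq_zero fun e he => ?_
  rw [mem_commonCouplings] at he
  by_cases h0 : sixJSum q a b c d e f = 0
  · rw [h0, mul_zero]
  · obtain ⟨-, h3, h4, -⟩ := qAdm_of_sixJSum_ne_zero he.1.1 h1 h2 he.2.1 h0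
    exact absurd ⟨h3, h4⟩ h

theorem racahNorm_eq_zero {q : ℂ} {a b c d g f : ℤ} (h : ¬(QAdm q a d f ∧ QAdm q c b f)) :
    racahNorm q a b c d g f = 0 :=
  if_neg fun h' => h h'.2

theorem racahPairing_eq_racahNorm_of_not_qAdm {q : ℂ} {a b c d g f : ℤ} (h1 : 2 ∣ a + d + f)
    (h2 : 2 ∣ c + b + f) (h : ¬(QAdm q a d f ∧ QAdm q c b f)) :
    racahPairing q a b c d g f = racahNorm q a b c d g f := by
  rw [racahPairing_eq_zero h1 h2 h, racahNorm_eq_zero h]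

theorem racahOrthogonal_of_qAdm {q : ℂ} {a b c d : ℤ}
    (h : ∀ g f : ℤ, QAdm q a d g → QAdm q c b g → QAdm q a d f → QAdm q c b f →
      racahPairing q a b c d g f = racahNorm q a b c d g f) : RacahOrthogonal q a b c d := by
  intro g f h1 h2 h3 h4
  by_cases hf : QAdm q a d f ∧ QAdm q c b f
  · by_cases hg : QAdm q a d g ∧ QAdm q c b g
    · exact h g f hg.1 hg.2 hf.1 hf.2
    · rw [racahPairing_comm, racahNorm_comm]
      exact racahPairing_eq_racahNorm_of_not_qAdm h1 h2 hg
  · exact racahPairing_eq_racahNorm_of_not_qAdm h3 h4 hf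

theorem RacahOrthogonal.swap {q : ℂ} {a b c d : ℤ} (h : RacahOrthogonal q b a d c) :
    RacahOrthogonal q a b c d := by
  intro g f h1 h2 h3 h4
  have key := h g f (by omega) (by omega) (by omega) (by omega)
  have hE : commonCouplings q b a d c = commonCouplings q a b c d := by
    ext e
    rw [mem_commonCouplings, mem_commonCouplings]
    exact and_congr ⟨QAdm.swap, QAdm.swap⟩ ⟨QAdm.swap, QAdm.swap⟩
  rw [racahPairing, racahNorm, hE] at key
  simp only [sixJSum_swap, triangleCoeff_swap q b a, triangleCoeff_swap q d c] at key
  rw [racahPairing, racahNorm, key]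
  have : (g = f ∧ QAdm q b c f ∧ QAdm q d a f) ↔ (g = f ∧ QAdm q a d f ∧ QAdm q c b f) :=
    and_congr Iff.rfl ⟨fun h => ⟨h.2.swap, h.1.swap⟩, fun h => ⟨h.2.swap, h.1.swap⟩⟩
  refine if_congr this ?_ rfl
  rw [triangleCoeff_swap q b c, triangleCoeff_swap q d a, mul_right_comm]

theorem RacahOrthogonal.flip {q : ℂ} {a b c d : ℤ} (h : RacahOrthogonal q c d a b) :
    RacahOrthogonal q a b c d := by
  intro g f h1 h2 h3 h4
  have key := h g f (by omega) (by omega) (by omega) (by omega)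
  have hE : commonCouplings q c d a b = commonCouplings q a b c d := by
    ext e
    rw [mem_commonCouplings, mem_commonCouplings, and_comm]
  rw [racahPairing, racahNorm, hE] at key
  simp only [sixJSum_flip] at key
  rw [racahPairing, racahNorm]
  have : (g = f ∧ QAdm q c b f ∧ QAdm q a d f) ↔ (g = f ∧ QAdm q a d f ∧ QAdm q c b f) :=
    and_congr Iff.rfl and_comm
  refine (Finset.sum_congr rfl fun e _ => by ring).trans (key.trans (if_congr this ?_ rfl))
  rw [mul_right_comm]

/-- Moves a multiplier from one column to the other. The ranges of `e` before and after the shift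
differ, but each column vanishes outside its own range, so only the intersection counts. -/
theorem sum_mul_eq_sum_mul_of_inter {ι : Type*} {E E' : Finset ι} {W W' α α' r r' : ι → ℂ}
    (hW : ∀ e ∈ E, e ∈ E' → W e * α' e = W' e * α e) (h : ∀ e ∈ E, e ∉ E' → r' e = 0)
    (h' : ∀ e ∈ E', e ∉ E → r e = 0) :
    ∑ e ∈ E, W e * r e * (α' e * r' e) = ∑ e ∈ E', W' e * (α e * r e) * r' e := by
  classical
  rw [← Finset.sum_subset (s₁ := E ∩ E') Finset.inter_subset_left,
    ← Finset.sum_subset (s₁ := E ∩ E') Finset.inter_subset_right]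
  · refine Finset.sum_congr rfl fun e he => ?_
    rw [Finset.mem_inter] at he
    linear_combination r e * r' e * hW e he.1 he.2
  · intro e he he'
    rw [h' e he fun h0 => he' (Finset.mem_inter.mpr ⟨h0, he⟩)]
    ring
  · intro e he he'
    rw [h e he fun h0 => he' (Finset.mem_inter.mpr ⟨he, h0⟩)]
    ring

/-! ### Recurrences for the pairing -/

/-- Orthogonality with outer labels `a', b', c, d` gives a recurrence for the pairing with outer
labels `a, b, c, d`. -/
theorem racahPairing_recurrence {q : ℂ} {a b a' b' c d g f : ℤ} {α α' : ℤ → ℂ}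
    {β₁ γ₁ β₂ γ₂ : ℂ} (hO : RacahOrthogonal q a' b' c d)
    (hab : 2 ∣ a' + b' - a - b) (ha : 2 ∣ a' - a - 1)
    (hg : QAdm q a d g) (hg' : QAdm q c b g) (hf : QAdm q a' d (f - 1)) (hf' : QAdm q c b' (f - 1))
    (hα : ∀ e, QAdm q a b e → QAdm q a' b' e →
      triangleCoeff q a b e * α' e = triangleCoeff q a' b' e * α e)
    (h₂ : ∀ e ∈ commonCouplings q a b c d, qNum q f * (α' e * sixJSum q a' b' c d e (f - 1))
      = β₂ * sixJSum q a b c d e f + γ₂ * sixJSum q a b c d e (f - 2))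
    (h₁ : ∀ e ∈ commonCouplings q a' b' c d, qNum q (g + 1) * (α e * sixJSum q a b c d e g)
      = β₁ * sixJSum q a' b' c d e (g - 1) + γ₁ * sixJSum q a' b' c d e (g + 1))
    (hβ : g = f → β₂ * triangleCoeff q a' d (f - 1) * triangleCoeff q c b' (f - 1)
      = β₁ * triangleCoeff q a d f * triangleCoeff q c b f)
    (hγ : g = f - 2 → γ₂ * triangleCoeff q a' d (f - 1) * triangleCoeff q c b' (f - 1)
      = γ₁ * triangleCoeff q a d (f - 2) * triangleCoeff q c b (f - 2)) :
    β₂ * racahPairing q a b c d g f + γ₂ * racahPairing q a b c d g (f - 2)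
      = β₂ * racahNorm q a b c d g f + γ₂ * racahNorm q a b c d g (f - 2) := by
  have pg := hg.1
  have pg' := hg'.1
  have pf := hf.1
  have pf' := hf'.1
  have hexch := sum_mul_eq_sum_mul_of_inter (E := commonCouplings q a b c d)
    (E' := commonCouplings q a' b' c d)
    (W := fun e => qNum q (e + 1) * triangleCoeff q a b e * triangleCoeff q c d e)
    (W' := fun e => qNum q (e + 1) * triangleCoeff q a' b' e * triangleCoeff q c d e)
    (α := α) (α' := α') (r := fun e => sixJSum q a b c d e g)
    (r' := fun e => sixJSum q a' b' c d e (f - 1))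
    (by
      intro e he he'
      rw [mem_commonCouplings] at he he'
      linear_combination qNum q (e + 1) * triangleCoeff q c d e * hα e he.1 he'.1)
    (by
      intro e he he'
      rw [mem_commonCouplings] at he he'
      by_contra h0
      have pe := he.1.1
      obtain ⟨k1, -, -, k2⟩ := qAdm_of_sixJSum_ne_zero (by omega) pf pf' he.2.1 h0
      exact he' ⟨k1, k2⟩)
    (by
      intro e he he'
      rw [mem_commonCouplings] at he he'
      by_contra h0
      have pe := he.1.1
      obtain ⟨k1, -, -, k2⟩ := qAdm_of_sixJSum_ne_zero (by omega) pg pg' he.2.1 h0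
      exact he' ⟨k1, k2⟩)
  beta_reduce at hexch
  have hl : qNum q f * ∑ e ∈ commonCouplings q a b c d,
      qNum q (e + 1) * triangleCoeff q a b e * triangleCoeff q c d e * sixJSum q a b c d e g
        * (α' e * sixJSum q a' b' c d e (f - 1))
      = β₂ * racahPairing q a b c d g f + γ₂ * racahPairing q a b c d g (f - 2) := by
    rw [racahPairing, racahPairing, Finset.mul_sum, Finset.mul_sum, Finset.mul_sum,
      ← Finset.sum_add_distrib]
    refine Finset.sum_congr rfl fun e he => ?_
    linear_combination (qNum q (e + 1) * triangleCoeff q a b e * triangleCoeff q c d e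
      * sixJSum q a b c d e g) * h₂ e he
  have hr : qNum q (g + 1) * ∑ e ∈ commonCouplings q a' b' c d,
      qNum q (e + 1) * triangleCoeff q a' b' e * triangleCoeff q c d e
        * (α e * sixJSum q a b c d e g) * sixJSum q a' b' c d e (f - 1)
      = β₁ * racahPairing q a' b' c d (g - 1) (f - 1)
        + γ₁ * racahPairing q a' b' c d (g + 1) (f - 1) := by
    rw [racahPairing, racahPairing, Finset.mul_sum, Finset.mul_sum, Finset.mul_sum,
      ← Finset.sum_add_distrib]
    refine Finset.sum_congr rfl fun e he => ?_
    linear_combination (qNum q (e + 1) * triangleCoeff q a' b' e * triangleCoeff q c d e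
      * sixJSum q a' b' c d e (f - 1)) * h₁ e he
  rw [hO _ _ (by omega) (by omega) (by omega) (by omega),
    hO _ _ (by omega) (by omega) (by omega) (by omega)] at hr
  have hg0 : qNum q (g + 1) ≠ 0 := by
    have := hg.2.1
    exact hg.qNum_ne_zero (by omega) (by omega)
  have hf0 : qNum q f ≠ 0 := by
    have := hf.2.1
    exact hf.qNum_ne_zero (by omega) (by omega)
  have hT := hf.triangleCoeff_ne_zero
  have hT' := hf'.triangleCoeff_ne_zero
  rw [← hl, hexch]
  -- The factor `[g+1]` is what allows the relation `h₁` to be applied to the column `g`.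
  refine mul_left_cancel₀ hg0 ?_
  rw [mul_left_comm, hr]
  -- The shifted pairings are now diagonal. Only `g = f` and `g = f - 2` contribute, and there `hβ`
  -- and `hγ` match the norms.
  rcases eq_or_ne g f with rfl | h1
  · rw [racahNorm, if_pos ⟨rfl, hf, hf'⟩, racahNorm, if_neg (by omega), racahNorm,
      if_pos ⟨rfl, hg, hg'⟩, racahNorm, if_neg (by omega), sub_add_cancel]
    have hS := hg.triangleCoeff_ne_zero
    have hS' := hg'.triangleCoeff_ne_zero
    have := hβ rfl
    field_simp
    linear_combination -this
  rcases eq_or_ne g (f - 2) with rfl | h2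
  · rw [racahNorm, if_neg (by omega), racahNorm, if_pos ⟨by ring, hf, hf'⟩, racahNorm,
      if_neg (by omega), racahNorm, if_pos ⟨rfl, hg, hg'⟩, sub_add_cancel]
    have hS := hg.triangleCoeff_ne_zero
    have hS' := hg'.triangleCoeff_ne_zero
    have := hγ rfl
    field_simp
    linear_combination -this
  · rw [racahNorm, if_neg (by omega), racahNorm, if_neg (by omega), racahNorm,
      if_neg (by omega), racahNorm, if_neg (by omega)]
    ring

theorem triangleCoeff_swap_right (q : ℂ) (a b c : ℤ) :
    triangleCoeff q a b c = triangleCoeff q a c b := by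
  rw [triangleCoeff_rotate, triangleCoeff_swap, triangleCoeff_rotate, triangleCoeff_rotate]

theorem QAdm.swap_right {q : ℂ} {a b c : ℤ} (h : QAdm q a b c) : QAdm q a c b :=
  h.rotate.rotate.swap.rotate.rotate.rotate

/-- `sixJSum_lower` and `sixJSum_raise` are adjoint: their multipliers `[(a+b-e)/2]` and
`[(a+b+e)/2+1]` have the quotient that relates the two triangle coefficients. -/
theorem racahPairing_recurrence_lower {q : ℂ} (hq : q ≠ 0) {a b c d g f : ℤ}
    (hO : RacahOrthogonal q (a - 1) (b - 1) c d) (hg : QAdm q a d g) (hg' : QAdm q c b g)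
    (hf : QAdm q (a - 1) d (f - 1)) (hf' : QAdm q c (b - 1) (f - 1)) :
    -(qNum q ((b + f - c) / 2) * qNum q ((a + f - d) / 2)) * racahPairing q a b c d g f
        + qNum q ((b + c - f) / 2 + 1) * qNum q ((a + d - f) / 2 + 1)
          * racahPairing q a b c d g (f - 2)
      = -(qNum q ((b + f - c) / 2) * qNum q ((a + f - d) / 2)) * racahNorm q a b c d g f
        + qNum q ((b + c - f) / 2 + 1) * qNum q ((a + d - f) / 2 + 1)
          * racahNorm q a b c d g (f - 2) := by
  refine racahPairing_recurrence
    (β₁ := -(qNum q ((a + d + g) / 2 + 1) * qNum q ((c + b + g) / 2 + 1)))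
    (γ₁ := qNum q ((d + g - a) / 2 + 1) * qNum q ((c + g - b) / 2 + 1)) hO (by omega) (by omega) hg hg' hf hf'
    (fun e h h' => triangleCoeff_lower h h') (fun e he => ?_)
    (fun e he => ?_) (fun h => ?_) (fun h => ?_)
  · rw [mem_commonCouplings] at he
    have := hf.2.1
    have := hf'.2.1
    have := he.1.2.1
    exact sixJSum_raise hq hf hf' he.1.1 (by omega)
  · rw [mem_commonCouplings] at he
    have := he.1.2.1
    exact sixJSum_lower hq hg hg' he.2.1 (by omega)
  · subst h
    have h1 := triangleCoeff_lower hg.swap_right hf.swap_right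
    have h2 := triangleCoeff_lower hg'.rotate hf'.rotate
    rw [triangleCoeff_swap_right q (a - 1) d, triangleCoeff_swap_right q a d,
      triangleCoeff_rotate q c, triangleCoeff_rotate q c]
    rw [show a + g + d = a + d + g by ring] at h1
    rw [show b + g + c = c + b + g by ring] at h2
    linear_combination qNum q ((c + b + g) / 2 + 1) * triangleCoeff q b g c * h1
      + triangleCoeff q (a - 1) (g - 1) d * qNum q ((a + g - d) / 2) * h2
  · obtain rfl : f = g + 2 := by omega
    rw [show g + 2 - 1 = g + 1 by ring] at *
    have h1 := triangleCoeff_mixed hg.swap_right hf.swap_right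
    have h2 := triangleCoeff_mixed hg'.rotate hf'.rotate
    have h3 := hg.1
    have h4 := hg'.1
    rw [triangleCoeff_swap_right q (a - 1) d, triangleCoeff_swap_right q a d,
      triangleCoeff_rotate q c, triangleCoeff_rotate q c, ← h]
    rw [show g + d - a = d + g - a by ring,
      show (a + d - g) / 2 = (a + d - (g + 2)) / 2 + 1 by omega] at h1
    rw [show g + c - b = c + g - b by ring,
      show (b + c - g) / 2 = (b + c - (g + 2)) / 2 + 1 by omega] at h2
    linear_combination -qNum q ((c + g - b) / 2 + 1) * triangleCoeff q b g c * h1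
      - triangleCoeff q (a - 1) (g + 1) d * qNum q ((a + d - (g + 2)) / 2 + 1) * h2

theorem racahPairing_recurrence_mixed {q : ℂ} (hq : q ≠ 0) {a b c d g f : ℤ}
    (hO : RacahOrthogonal q (a - 1) (b + 1) c d) (hg : QAdm q a d g) (hg' : QAdm q c b g)
    (hf : QAdm q (a - 1) d (f - 1)) (hf' : QAdm q c (b + 1) (f - 1)) :
    qNum q ((c + f - b) / 2) * qNum q ((a + f - d) / 2) * racahPairing q a b c d g f
        + qNum q ((b + c + f) / 2 + 1) * qNum q ((a + d - f) / 2 + 1)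
          * racahPairing q a b c d g (f - 2)
      = qNum q ((c + f - b) / 2) * qNum q ((a + f - d) / 2) * racahNorm q a b c d g f
        + qNum q ((b + c + f) / 2 + 1) * qNum q ((a + d - f) / 2 + 1)
          * racahNorm q a b c d g (f - 2) := by
  have p1 := hf.1
  have p2 := hf'.1
  refine racahPairing_recurrence
    (β₁ := qNum q ((a + d + g) / 2 + 1) * qNum q ((b + c - g) / 2 + 1))
    (γ₁ := qNum q ((d + g - a) / 2 + 1) * qNum q ((b + g - c) / 2 + 1)) hO (by omega) (by omega) hg hg' hf hf'
    (fun e h h' => triangleCoeff_mixed h h') (fun e he => ?_)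
    (fun e he => ?_) (fun h => ?_) (fun h => ?_)
  · rw [mem_commonCouplings] at he
    have h1 := he.1.1
    have h2 := he.2.1
    have h3 := he.1.2.1
    -- With the roles of `a` and `b` exchanged, the mixed relation undoes its own shift, so it is
    -- its own adjoint partner.
    have key := sixJSum_mixed hq (e := e) hf'.rotate.swap_right hf.rotate.swap_right (by omega)
      (by omega)
    simp only [sixJSum_swap q (a - 1) (b + 1)] at key
    rw [show f - 1 + 1 = f by ring, show f - 1 - 1 = f - 2 by ring,
      show b + 1 - 1 = b by ring, show a - 1 + 1 = a by ring, sixJSum_swap q a b c d e (f - 2),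
      sixJSum_swap q a b c d e f,
      show (b + 1 + e - (a - 1)) / 2 = (b + e - a) / 2 + 1 by omega,
      show (b + 1 + c + (f - 1)) / 2 = (b + c + f) / 2 by omega,
      show (a - 1 + d - (f - 1)) / 2 = (a + d - f) / 2 by omega,
      show (c + (f - 1) - (b + 1)) / 2 + 1 = (c + f - b) / 2 by omega,
      show (a - 1 + (f - 1) - d) / 2 + 1 = (a + f - d) / 2 by omega] at key
    linear_combination key
  · rw [mem_commonCouplings] at he
    have h3 := he.1.2.1
    exact sixJSum_mixed hq hg hg' he.2.1 (by omega)
  · subst h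
    have h1 := triangleCoeff_lower hg.swap_right hf.swap_right
    have h2 := triangleCoeff_mixed hg'.rotate.swap hf'.rotate.swap
    rw [triangleCoeff_swap_right q (a - 1) d, triangleCoeff_swap_right q a d,
      triangleCoeff_rotate q c, triangleCoeff_rotate q c, triangleCoeff_swap q (b + 1),
      triangleCoeff_swap q b]
    rw [show a + g + d = a + d + g by ring] at h1
    rw [show g + c - b = c + g - b by ring] at h2
    linear_combination -qNum q ((b + c - g) / 2 + 1) * triangleCoeff q g b c * h1
      - triangleCoeff q (a - 1) (g - 1) d * qNum q ((a + g - d) / 2) * h2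
  · obtain rfl : f = g + 2 := by omega
    rw [show g + 2 - 1 = g + 1 by ring] at *
    have h1 := triangleCoeff_mixed hg.swap_right hf.swap_right
    have h2 := triangleCoeff_lower hf'.rotate (by simpa using hg'.rotate)
    have h3 := hg.1
    have h4 := hg'.1
    rw [triangleCoeff_swap_right q (a - 1) d, triangleCoeff_swap_right q a d,
      triangleCoeff_rotate q c, triangleCoeff_rotate q c, ← h]
    rw [show g + d - a = d + g - a by ring,
      show (a + d - g) / 2 = (a + d - (g + 2)) / 2 + 1 by omega] at h1
    rw [show b + 1 - 1 = b by ring, show g + 1 - 1 = g by ring,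
      show b + 1 + (g + 1) + c = b + c + (g + 2) by ring,
      show (b + 1 + (g + 1) - c) / 2 = (b + g - c) / 2 + 1 by omega] at h2
    linear_combination -qNum q ((b + g - c) / 2 + 1) * triangleCoeff q b g c * h1
      + triangleCoeff q (a - 1) (g + 1) d * qNum q ((a + d - (g + 2)) / 2 + 1) * h2

/-! ### The column zero: a quantum dimension count -/

theorem sum_range_qNum {q : ℂ} (hq : q ≠ 0) (m : ℤ) (k : ℕ) :
    ∑ j ∈ Finset.range k, qNum q (m + 2 * j + 1) = qNum q k * qNum q (k + m) := by
  induction k with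
  | zero => simp [qNum_zero]
  | succ k ih =>
    have h := qNum_sub_mul_qNum_sub q hq (m + 2 * k + 1) k (k + m)
    rw [show m + 2 * (k : ℤ) + 1 - k = k + 1 + m by ring,
      show m + 2 * (k : ℤ) + 1 - (k + m) = k + 1 by ring,
      show (k : ℤ) + 1 + m - (k + m) = 1 by ring, qNum_one] at h
    rw [Finset.sum_range_succ, ih]
    push_cast
    linear_combination -h

/-- The labels `e` form a progression of step `2` starting at `b - a`, with `a + 1` terms, or `r - 1
- b` terms if cut off by the first vanishing factorial `[r]!`. In the latter case `[r] = 0`, and the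
reflection `[r-x] [r-y] = [x] [y]` restores the same product. -/
theorem exists_qAdm_iff {q : ℂ} (hq : q ≠ 0) {a b : ℤ} (ha0 : 0 ≤ a) (hab : a ≤ b)
    (hb : qFact q (b + 1).toNat ≠ 0) :
    ∃ k : ℕ, (∀ e, QAdm q a b e ↔ ∃ j < k, e = b - a + 2 * (j : ℤ)) ∧
      qNum q k * qNum q (k + (b - a)) = qNum q (a + 1) * qNum q (b + 1) := by
  by_cases h : ∃ n, qFact q n = 0
  · classical
    set r := Nat.find h with hr
    have h1 : ∀ n, qFact q n ≠ 0 ↔ n < r := by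
      refine fun n => ⟨fun hn => ?_, fun hn => Nat.find_min h hn⟩
      by_contra hlt
      exact qFact_ne_zero_of_le (not_lt.mp hlt) hn (Nat.find_spec h)
    have hr0 : qNum q r = 0 := by
      have h2 := Nat.find_spec h
      rw [← hr] at h2
      have h3 : (b + 1).toNat < r := (h1 _).mp hb
      obtain ⟨n, hn⟩ : ∃ n, r = n + 1 := ⟨r - 1, by omega⟩
      rw [hn, qFact_succ] at h2
      rw [hn, qNum_natCast]
      exact (mul_eq_zero.mp h2).resolve_right ((h1 n).mpr (by omega))
    rw [h1] at hb
    rcases le_or_gt (r : ℤ) (a + b + 1) with hle | hle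
    · refine ⟨(r - 1 - b).toNat, fun e => ?_, ?_⟩
      · rw [QAdm, h1]
        constructor
        · rintro ⟨h2, h3, h4⟩
          exact ⟨((e - (b - a)) / 2).toNat, by omega, by omega⟩
        · rintro ⟨j, hj, rfl⟩
          refine ⟨by omega, by omega, by omega⟩
      · have h2 := qNum_sub_mul_qNum_sub q hq r (b + 1) (a + 1)
        rw [hr0, zero_mul, add_zero] at h2
        rw [show (((r : ℤ) - 1 - b).toNat : ℤ) = r - (b + 1) by omega,
          show (r : ℤ) - (b + 1) + (b - a) = r - (a + 1) by ring, h2, mul_comm]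
    · refine ⟨(a + 1).toNat, fun e => ?_, ?_⟩
      · rw [QAdm, h1]
        constructor
        · rintro ⟨h2, h3, h4⟩
          exact ⟨((e - (b - a)) / 2).toNat, by omega, by omega⟩
        · rintro ⟨j, hj, rfl⟩
          refine ⟨by omega, by omega, by omega⟩
      · rw [show ((a + 1).toNat : ℤ) = a + 1 by omega, show a + 1 + (b - a) = b + 1 by ring]
  · refine ⟨(a + 1).toNat, fun e => ?_, ?_⟩
    · constructor
      · rintro ⟨h2, h3, h4⟩
        exact ⟨((e - (b - a)) / 2).toNat, by omega, by omega⟩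
      · rintro ⟨j, hj, rfl⟩
        exact ⟨by omega, by omega, fun h0 => h ⟨_, h0⟩⟩
    · rw [show ((a + 1).toNat : ℤ) = a + 1 by omega, show a + 1 + (b - a) = b + 1 by ring]

theorem sum_commonCouplings_qNum {q : ℂ} (hq : q ≠ 0) {a b : ℤ} (ha0 : 0 ≤ a) (hab : a ≤ b)
    (hb : qFact q (b + 1).toNat ≠ 0) :
    ∑ e ∈ commonCouplings q a b b a, qNum q (e + 1) = qNum q (a + 1) * qNum q (b + 1) := by
  obtain ⟨k, hk, hk'⟩ := exists_qAdm_iff hq ha0 hab hb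
  have hE : commonCouplings q a b b a
      = (Finset.range k).image fun j : ℕ => b - a + 2 * (j : ℤ) := by
    ext e
    rw [mem_commonCouplings, Finset.mem_image]
    simp only [Finset.mem_range]
    rw [and_iff_left_of_imp QAdm.swap, hk]
    exact ⟨fun ⟨j, hj, h⟩ => ⟨j, hj, h.symm⟩, fun ⟨j, hj, h⟩ => ⟨j, hj, h.symm⟩⟩
  rw [hE, Finset.sum_image fun x _ y _ h => by simpa using h, sum_range_qNum hq, hk']

/-- For `f = 0` one has `t₁ = t₄ = u₂ = u₃`, so a single summand survives. It is, up to sign, the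
inverse of the triangle coefficient. -/
theorem triangleCoeff_mul_sixJSum_self {q : ℂ} {a b e : ℤ} (h : QAdm q a b e) :
    (triangleCoeff q a b e * sixJSum q a b b a e 0) ^ 2 = 1 := by
  obtain ⟨h1, h2, h3⟩ := h
  obtain ⟨s, hs⟩ : ∃ s : ℕ, (a + b + e) / 2 = s := ⟨((a + b + e) / 2).toNat, by omega⟩
  have hF : ∀ n : ℤ, n ≤ s → qFact q n.toNat ≠ 0 := fun n hn =>
    qFact_ne_zero_of_le (by omega) h3
  have hS : sixJSum q a b b a e 0 = (-1) ^ s * qFact q (s + 1)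
      * (qFact q ((a + b - e) / 2).toNat * qFact q ((a + e - b) / 2).toNat
        * qFact q ((b + e - a) / 2).toNat)⁻¹ := by
    rw [sixJSum, racahSum, Finset.sum_eq_single s]
    · have e0 : qInvFact q 0 = 1 := by simp [qInvFact, qFact]
      rw [racahTerm, show (b + a + e) / 2 = s by omega, show (b + e + a + 0) / 2 = s by omega,
        show (a + e + b + 0) / 2 = s by omega, hs, sub_self, e0,
        show s - (a + a + 0) / 2 = (b + e - a) / 2 by omega,
        show s - (b + b + 0) / 2 = (a + e - b) / 2 by omega,
        show (a + b + b + a) / 2 - s = (a + b - e) / 2 by omega, qInvFact, qInvFact, qInvFact,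
        if_pos (by omega), if_pos (by omega), if_pos (by omega), mul_inv, mul_inv]
      ring
    · intro s' _ hs'
      by_contra h0
      have := (racahTerm_ne_zero h0).2
      omega
    · intro hs'
      simp at hs'
      omega
  rw [hS, triangleCoeff, show ((a + b + e) / 2 + 1).toNat = s + 1 by omega]
  rw [show ((a + b + e) / 2 + 1).toNat = s + 1 by omega] at h3
  have k1 := hF ((a + b - e) / 2) (by omega)
  have k2 := hF ((a + e - b) / 2) (by omega)
  have k3 := hF ((b + e - a) / 2) (by omega)
  field_simp
  rw [← pow_mul, mul_comm s 2, pow_mul]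
  simp

theorem triangleCoeff_self_zero {q : ℂ} {a : ℤ} (h : QAdm q a a 0) :
    triangleCoeff q a a 0 = (qNum q (a + 1))⁻¹ := by
  have h0 := h.2.1
  have h2 := h.2.2
  have hF := qFact_ne_zero_of_le (m := a.toNat) (by omega) h2
  rw [triangleCoeff, show (a + a - 0) / 2 = a by omega, show (a + 0 - a) / 2 = 0 by omega,
    show (a + a + 0) / 2 + 1 = a + 1 by omega, qFact_toNat q (n := a + 1) (by omega),
    add_sub_cancel_right, show qFact q (0 : ℤ).toNat = 1 by simp [qFact], mul_one, mul_one,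
    div_mul_cancel_right₀ hF]

theorem racahPairing_zero_zero {q : ℂ} (hq : q ≠ 0) {a b : ℤ} (ha : QAdm q a a 0)
    (hb : QAdm q b b 0) : racahPairing q a b b a 0 0 = racahNorm q a b b a 0 0 := by
  have h1 : racahPairing q a b b a 0 0 = ∑ e ∈ commonCouplings q a b b a, qNum q (e + 1) := by
    refine Finset.sum_congr rfl fun e he => ?_
    rw [mem_commonCouplings] at he
    rw [triangleCoeff_swap q b a]
    linear_combination qNum q (e + 1) * triangleCoeff_mul_sixJSum_self he.1
  rw [h1, racahNorm, if_pos ⟨rfl, ha, hb⟩, triangleCoeff_self_zero ha, triangleCoeff_self_zero hb,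
    zero_add, qNum_one, one_mul, mul_inv, inv_inv, inv_inv]
  have ha2 := ha.2.2
  have hb2 := hb.2.2
  have ha1 := ha.2.1
  have hb1 := hb.2.1
  rw [show (a + a + 0) / 2 + 1 = a + 1 by omega] at ha2
  rw [show (b + b + 0) / 2 + 1 = b + 1 by omega] at hb2
  rcases le_total a b with h | h
  · exact sum_commonCouplings_qNum hq (by omega) h hb2
  · rw [mul_comm, ← sum_commonCouplings_qNum hq (by omega) h ha2]
    refine Finset.sum_congr ?_ fun _ _ => rfl
    ext e
    rw [mem_commonCouplings, mem_commonCouplings, and_comm]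

/-! ### Induction on the outer labels -/

theorem racahPairing_eq_racahNorm_step {q : ℂ} (hq : q ≠ 0) {a b c d g f : ℤ}
    (hdom : b - c ≤ a - d) (hdom' : c - b ≤ a - d)
    (ih : ∀ b', 0 ≤ a - 1 → 0 ≤ b' → 0 ≤ c → 0 ≤ d →
      2 * (a - 1 + b' + c + d) + |a - 1 - d| + |b' - c|
        < 2 * (a + b + c + d) + |a - d| + |b - c| → RacahOrthogonal q (a - 1) b' c d)
    (hg : QAdm q a d g) (hg' : QAdm q c b g) (hf : QAdm q a d f) (hf' : QAdm q c b f)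
    (hf0 : 0 < f) (hprev : racahPairing q a b c d g (f - 2) = racahNorm q a b c d g (f - 2)) :
    racahPairing q a b c d g f = racahNorm q a b c d g f := by
  obtain ⟨h1, h2, h3⟩ := id hf
  obtain ⟨h4, h5, h6⟩ := id hf'
  have n1 : qNum q ((a + f - d) / 2) ≠ 0 := hf.qNum_ne_zero (by omega) (by omega)
  have k1 : QAdm q (a - 1) d (f - 1) :=
    ⟨by omega, by omega, qFact_ne_zero_of_le (by omega) h3⟩
  -- Lowering `b` needs `c - b < f`, which follows from `c - b ≤ a - d ≤ f` unless both are
  -- equalities. Raising `b` covers that case: the label sum is unchanged, but both absolute values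
  -- in the measure drop.
  by_cases hcase : c - b = a - d ∧ 0 < a - d
  · have k2 : QAdm q c (b + 1) (f - 1) :=
      ⟨by omega, by omega, qFact_ne_zero_of_le (by omega) h6⟩
    have n2 : qNum q ((c + f - b) / 2) ≠ 0 := hf'.qNum_ne_zero (by omega) (by omega)
    have key := racahPairing_recurrence_mixed hq
      (ih (b + 1) (by omega) (by omega) (by omega) (by omega) (by
        rw [abs_of_nonneg (by omega : 0 ≤ a - 1 - d), abs_of_nonneg (by omega : 0 ≤ a - d),
          abs_of_nonpos (by omega : b + 1 - c ≤ 0), abs_of_nonpos (by omega : b - c ≤ 0)]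
        omega)) hg hg' k1 k2
    rw [hprev] at key
    exact mul_left_cancel₀ (mul_ne_zero n2 n1) (add_right_cancel key)
  · have k2 : QAdm q c (b - 1) (f - 1) :=
      ⟨by omega, by omega, qFact_ne_zero_of_le (by omega) h6⟩
    have n2 : qNum q ((b + f - c) / 2) ≠ 0 := hf'.qNum_ne_zero (by omega) (by omega)
    have key := racahPairing_recurrence_lower hq
      (ih (b - 1) (by omega) (by omega) (by omega) (by omega) (by
        -- Each absolute value grows by at most one, while twice the label sum drops by four.
        have e1 := abs_sub_abs_le_abs_sub (a - 1 - d) (a - d)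
        have e2 := abs_sub_abs_le_abs_sub (b - 1 - c) (b - c)
        rw [show a - 1 - d - (a - d) = -1 by ring, abs_neg, abs_one] at e1
        rw [show b - 1 - c - (b - c) = -1 by ring, abs_neg, abs_one] at e2
        omega)) hg hg' k1 k2
    rw [hprev] at key
    exact mul_left_cancel₀ (neg_ne_zero.mpr (mul_ne_zero n2 n1)) (add_right_cancel key)

/-- The recurrence climbs in `f` by steps of two. It starts where `f - 2` is inadmissible, both
sides being zero there, or at `f = 0`, which has to be settled separately. -/
theorem racahOrthogonal_of_dominant {q : ℂ} (hq : q ≠ 0) {a b c d : ℤ}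
    (hdom : b - c ≤ a - d) (hdom' : c - b ≤ a - d)
    (ih : ∀ b', 0 ≤ a - 1 → 0 ≤ b' → 0 ≤ c → 0 ≤ d →
      2 * (a - 1 + b' + c + d) + |a - 1 - d| + |b' - c|
        < 2 * (a + b + c + d) + |a - d| + |b - c| → RacahOrthogonal q (a - 1) b' c d) :
    RacahOrthogonal q a b c d := by
  have hcol : ∀ g, QAdm q a d g → QAdm q c b g →
      (QAdm q a d 0 → QAdm q c b 0 → racahPairing q a b c d g 0 = racahNorm q a b c d g 0) →
      ∀ n : ℕ, QAdm q a d n → QAdm q c b n →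
        racahPairing q a b c d g n = racahNorm q a b c d g n := by
    intro g hg hg' h0 n
    induction n using Nat.strong_induction_on with
    | _ n ihn =>
      intro hn hn'
      rcases Nat.eq_zero_or_pos n with rfl | hpos
      · exact h0 hn hn'
      refine racahPairing_eq_racahNorm_step hq hdom hdom' ih hg hg' hn hn' (by omega) ?_
      have p1 := hn.1
      have p2 := hn'.1
      by_cases hm : QAdm q a d ((n : ℤ) - 2) ∧ QAdm q c b ((n : ℤ) - 2)
      · have := hm.1.2.1
        have key := ihn (n - 2) (by omega)
        rw [show ((n - 2 : ℕ) : ℤ) = n - 2 by omega] at key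
        exact key hm.1 hm.2
      · exact racahPairing_eq_racahNorm_of_not_qAdm (by omega) (by omega) hm
  have hbase : QAdm q a d 0 → QAdm q c b 0 →
      racahPairing q a b c d 0 0 = racahNorm q a b c d 0 0 := by
    intro h h'
    have h1 := h.2.1
    have h2 := h'.2.1
    obtain rfl : d = a := by omega
    obtain rfl : c = b := by omega
    exact racahPairing_zero_zero hq h h'
  refine racahOrthogonal_of_qAdm fun g f hg hg' hf hf' => ?_
  have hg0 : 0 ≤ g := by have := hg.2.1; omega
  have hf0 : 0 ≤ f := by have := hf.2.1; omega
  lift g to ℕ using hg0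
  lift f to ℕ using hf0
  refine hcol g hg hg' (fun h0 h0' => ?_) f hf hf'
  rw [racahPairing_comm, racahNorm_comm]
  -- The case `f = 0` is turned by symmetry into the column `0` paired with `g`, and the same climb,
  -- now in `g`, starts from the pair `(0, 0)`.
  exact hcol 0 h0 h0' (fun _ _ => hbase h0 h0') g hg hg'

theorem racahOrthogonal {q : ℂ} (hq : q ≠ 0) {a b c d : ℤ} (ha : 0 ≤ a) (hb : 0 ≤ b) (hc : 0 ≤ c)
    (hd : 0 ≤ d) : RacahOrthogonal q a b c d := by
  have key : ∀ n : ℕ, ∀ a b c d : ℤ, 0 ≤ a → 0 ≤ b → 0 ≤ c → 0 ≤ d →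
      2 * (a + b + c + d) + |a - d| + |b - c| = n → RacahOrthogonal q a b c d := by
    intro n
    induction n using Nat.strong_induction_on with
    | _ n ihn =>
      have ih : ∀ a b c d : ℤ, 0 ≤ a → 0 ≤ b → 0 ≤ c → 0 ≤ d →
          2 * (a + b + c + d) + |a - d| + |b - c| < n → RacahOrthogonal q a b c d := by
        intro a b c d ha hb hc hd hlt
        have p1 := abs_nonneg (a - d)
        have p2 := abs_nonneg (b - c)
        exact ihn (2 * (a + b + c + d) + |a - d| + |b - c|).toNat (by omega) a b c d ha hb hc hd
          (by omega)
      have hdom : ∀ a b c d : ℤ, b - c ≤ a - d → c - b ≤ a - d →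
          2 * (a + b + c + d) + |a - d| + |b - c| = n → RacahOrthogonal q a b c d :=
        fun a b c d h h' hn => racahOrthogonal_of_dominant hq h h' fun b' h1 h2 h3 h4 h5 =>
          ih _ _ _ _ h1 h2 h3 h4 (hn ▸ h5)
      intro a b c d ha hb hc hd hn
      have s1 := abs_sub_comm a d
      have s2 := abs_sub_comm b c
      -- The two symmetries exchange `a - d` with `b - c` and with `c - b`, so `a - d ≥ |b - c|` can
      -- always be arranged.
      rcases le_total (b - c) (a - d) with h | h <;> rcases le_total (c - b) (a - d) with h' | h'
      · exact hdom _ _ _ _ h h' hn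
      · exact (hdom c d a b (by omega) (by omega) (by omega)).flip
      · exact (hdom b a d c (by omega) (by omega) (by omega)).swap
      · exact (hdom d c b a (by omega) (by omega) (by omega)).swap.flip
  have p1 := abs_nonneg (a - d)
  have p2 := abs_nonneg (b - c)
  exact key (2 * (a + b + c + d) + |a - d| + |b - c|).toNat a b c d ha hb hc hd (by omega)

/-! ### Comparison with the definitions of the statement -/

theorem qInt_succ_eq_zero_iff {q : ℂ} (hq : q ≠ 0) (n : ℕ) :
    qInt q (n + 1) = 0 ↔ q ^ 2 ≠ 1 ∧ (q ^ 2) ^ (n + 1) = 1 := by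
  by_cases h : q ^ 2 = 1
  · have h1 : qInt q (n + 1) = (n + 1) * q ^ (n : ℤ) := by
      have h2 : ∀ k ∈ Finset.range (n + 1),
          q ^ (((n + 1 : ℕ) : ℤ) - 1 - 2 * (k : ℤ)) = q ^ (n : ℤ) := by
        intro k _
        rw [zpow_sub₀ hq, zpow_mul, zpow_ofNat, h, one_zpow, div_one]
        push_cast
        rw [add_sub_cancel_right]
      rw [qInt, Finset.sum_congr rfl h2]
      simp
    have h2 : (n : ℂ) + 1 ≠ 0 := by exact_mod_cast Nat.succ_ne_zero n
    simp [h1, h, h2, hq]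
  · have h1 : q - q⁻¹ ≠ 0 := by
      intro h0
      apply h
      field_simp at h0
      linear_combination h0
    have h2 : q ^ (n + 1) ≠ 0 := pow_ne_zero _ hq
    rw [← qNum_natCast, qNum_generic hq h, div_eq_zero_iff, or_iff_left h1, zpow_natCast,
      and_iff_right h, sub_eq_zero, ← pow_mul, two_mul,
      pow_add q (n + 1) (n + 1), mul_eq_one_iff_eq_inv₀ h2]

theorem qFact_ne_zero_iff {q : ℂ} (hq : q ≠ 0) (n : ℕ) :
    qFact q n ≠ 0 ↔ (2 ≤ orderOf (q ^ 2) → n < orderOf (q ^ 2)) := by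
  rw [qFact, Finset.prod_ne_zero_iff]
  constructor
  · intro h h2
    by_contra hn
    refine h (orderOf (q ^ 2) - 1) (by simp; omega) ?_
    rw [qInt_succ_eq_zero_iff hq, Nat.sub_add_cancel (by omega)]
    refine ⟨fun h1 => ?_, pow_orderOf_eq_one _⟩
    rw [h1, orderOf_one] at h2
    omega
  · intro h k hk h0
    rw [Finset.mem_range] at hk
    rw [qInt_succ_eq_zero_iff hq] at h0
    have h1 := orderOf_dvd_of_pow_eq_one h0.2
    have h2 := Nat.le_of_dvd (by omega) h1
    have h3 := Nat.pos_of_dvd_of_pos h1 (by omega)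
    have h4 : orderOf (q ^ 2) ≠ 1 := fun h5 => h0.1 (orderOf_eq_one_iff.mp h5)
    have := h (by omega)
    omega

/-- The bound by the order of `q ^ 2` says exactly that `[(a+b+c)/2+1]!`, in half-spin labels, does
not vanish. -/
theorem qAdmissible_iff_qAdm {q : ℂ} (hq : q ≠ 0) (a b c : ℕ) :
    QAdmissible q a b c ↔ QAdm q a b c := by
  rw [QAdmissible, QAdm, qFact_ne_zero_iff hq, Nat.even_iff]
  constructor
  · rintro ⟨h1, h2, h3⟩
    exact ⟨by omega, by omega, fun h => by have := h3 h; omega⟩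
  · rintro ⟨h1, h2, h3⟩
    exact ⟨by omega, by omega, fun h => by have := h3 h; omega⟩

theorem QAdm.qTriangle_eq {q : ℂ} {a b c : ℕ} (h : QAdm q a b c) :
    qTriangle q a b c = triangleCoeff q a b c := by
  have h1 := h.2.1
  rw [qTriangle, triangleCoeff, show (((a : ℤ) + b - c) / 2).toNat = (a + b - c) / 2 by omega,
    show (((a : ℤ) + c - b) / 2).toNat = (a + c - b) / 2 by omega,
    show (((b : ℤ) + c - a) / 2).toNat = (b + c - a) / 2 by omega,
    show (((a : ℤ) + b + c) / 2 + 1).toNat = (a + b + c) / 2 + 1 by omega]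

theorem qInvFact_sub_natCast (q : ℂ) {m n : ℕ} (h : n ≤ m) :
    qInvFact q ((m : ℤ) - n) = (qFact q (m - n))⁻¹ := by
  rw [← Nat.cast_sub h, qInvFact_natCast]

theorem qRacahSum_eq_sixJSum (q : ℂ) (a b e c d f : ℕ) :
    qRacahSum q a b e c d f = sixJSum q a b c d e f := by
  rw [qRacahSum, sixJSum]
  rw [show ((a : ℤ) + b + e) / 2 = ((a + b + e) / 2 : ℕ) by push_cast; rfl,
    show ((a : ℤ) + d + f) / 2 = ((a + d + f) / 2 : ℕ) by push_cast; rfl,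
    show ((c : ℤ) + b + f) / 2 = ((c + b + f) / 2 : ℕ) by push_cast; rfl,
    show ((c : ℤ) + d + e) / 2 = ((c + d + e) / 2 : ℕ) by push_cast; rfl,
    show ((a : ℤ) + b + c + d) / 2 = ((a + b + c + d) / 2 : ℕ) by push_cast; rfl,
    show ((b : ℤ) + e + d + f) / 2 = ((b + e + d + f) / 2 : ℕ) by push_cast; rfl,
    show ((a : ℤ) + e + c + f) / 2 = ((a + e + c + f) / 2 : ℕ) by push_cast; rfl]
  generalize (a + b + e) / 2 = t₁
  generalize (a + d + f) / 2 = t₂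
  generalize (c + b + f) / 2 = t₃
  generalize (c + d + e) / 2 = t₄
  generalize (a + b + c + d) / 2 = u₁
  generalize (b + e + d + f) / 2 = u₂
  generalize (a + e + c + f) / 2 = u₃
  rw [racahSum]
  have hsub : Finset.Icc (max (max t₁ t₂) (max t₃ t₄)) (min u₁ (min u₂ u₃))
      ⊆ Finset.range ((u₁ : ℤ).toNat + 1) := by
    intro s hs
    simp at hs ⊢
    omega
  refine (Finset.sum_congr rfl fun s hs => ?_).trans (Finset.sum_subset hsub fun s _ hs => ?_)
  · simp only [Finset.mem_Icc, max_le_iff, le_min_iff] at hs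
    obtain ⟨⟨⟨h1, h2⟩, h3, h4⟩, h5, h6, h7⟩ := hs
    rw [racahTerm, qInvFact_sub_natCast q h1, qInvFact_sub_natCast q h2,
      qInvFact_sub_natCast q h3, qInvFact_sub_natCast q h4, qInvFact_sub_natCast q h5,
      qInvFact_sub_natCast q h6, qInvFact_sub_natCast q h7, div_eq_mul_inv]
    simp only [mul_inv]
    ring
  · by_contra h0
    have := (racahTerm_ne_zero h0).2
    simp at hs
    omega

/-! ### Tetrahedral symmetries -/

theorem QAdmissible.swap {q : ℂ} {a b c : ℕ} (h : QAdmissible q a b c) : QAdmissible q b a c := by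
  obtain ⟨h1, h2, h3⟩ := h
  exact ⟨by rwa [add_comm b a], by omega, fun h => by have := h3 h; omega⟩

theorem QAdmissible.swap_right {q : ℂ} {a b c : ℕ} (h : QAdmissible q a b c) :
    QAdmissible q a c b := by
  obtain ⟨h1, h2, h3⟩ := h
  exact ⟨by rwa [add_right_comm], by omega, fun h => by have := h3 h; omega⟩

theorem qTriangle_swap (q : ℂ) (a b c : ℕ) : qTriangle q a b c = qTriangle q b a c := by
  rw [qTriangle, qTriangle, add_comm b a]
  ring

theorem qTriangle_swap_right (q : ℂ) (a b c : ℕ) : qTriangle q a b c = qTriangle q a c b := by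
  rw [qTriangle, qTriangle, add_comm c b, add_right_comm a c b]
  ring

/-- The summation range is tied to the first quadrangle sum, which changes here, so both sums are
first extended to a common range. -/
theorem racahSum_swap_right (q : ℂ) (t₁ t₂ t₃ t₄ u₁ u₂ u₃ : ℤ) :
    racahSum q t₁ t₂ t₄ t₃ u₃ u₂ u₁ = racahSum q t₁ t₂ t₃ t₄ u₁ u₂ u₃ := by
  rw [racahSum_eq_sum_range q _ _ _ _ u₃ _ _ (N := max u₁.toNat u₃.toNat + 1) (by omega),
    racahSum_eq_sum_range q _ _ _ _ u₁ _ _ (N := max u₁.toNat u₃.toNat + 1) (by omega)]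
  refine Finset.sum_congr rfl fun s _ => ?_
  simp only [racahTerm]
  ring

theorem qSixJ_swap (q : ℂ) (a b e c d f : ℕ) :
    qSixJ q a b e c d f = qSixJ q b a e d c f := by
  classical
  unfold qSixJ
  refine if_congr ⟨fun ⟨h1, h2, h3, h4⟩ => ⟨h1.swap, h3.swap, h2.swap, h4.swap⟩,
    fun ⟨h1, h2, h3, h4⟩ => ⟨h1.swap, h3.swap, h2.swap, h4.swap⟩⟩ ?_ rfl
  rw [qRacahSum_eq_sixJSum, qRacahSum_eq_sixJSum, sixJSum_swap, qTriangle_swap q b a,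
    qTriangle_swap q b c, qTriangle_swap q d a, qTriangle_swap q d c]
  ring

theorem qSixJ_flip (q : ℂ) (a b e c d f : ℕ) :
    qSixJ q a b e c d f = qSixJ q c d e a b f := by
  classical
  unfold qSixJ
  refine if_congr ⟨fun ⟨h1, h2, h3, h4⟩ => ⟨h4, h3, h2, h1⟩,
    fun ⟨h1, h2, h3, h4⟩ => ⟨h4, h3, h2, h1⟩⟩ ?_ rfl
  rw [qRacahSum_eq_sixJSum, qRacahSum_eq_sixJSum, sixJSum_flip]
  ring

theorem qSixJ_swap_right (q : ℂ) (a b e c d f : ℕ) :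
    qSixJ q a b e c d f = qSixJ q a e b c f d := by
  classical
  unfold qSixJ
  refine if_congr ⟨fun ⟨h1, h2, h3, h4⟩ =>
      ⟨h1.swap_right, h2.swap_right, h4.swap_right, h3.swap_right⟩,
    fun ⟨h1, h2, h3, h4⟩ =>
      ⟨h1.swap_right, h2.swap_right, h4.swap_right, h3.swap_right⟩⟩ ?_ rfl
  have hS : sixJSum q a e c f b d = sixJSum q a b c d e f := by
    rw [sixJSum, sixJSum, ← racahSum_swap_right]
    congr 2 <;> ring
  rw [qRacahSum_eq_sixJSum, qRacahSum_eq_sixJSum, hS, qTriangle_swap_right q a e,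
    qTriangle_swap_right q a f, qTriangle_swap_right q c e, qTriangle_swap_right q c f]
  ring

theorem qSixJ_eq_zero {q : ℂ} {a b e c d f : ℕ} (h : ¬(QAdmissible q a d f ∧ QAdmissible q c b f)) :
    qSixJ q a b e c d f = 0 :=
  if_neg fun h' => h ⟨h'.2.1, h'.2.2.1⟩

/-! ### Orthogonality of the normalized symbols -/

theorem cpow_half_mul_self (z : ℂ) : z ^ (1 / 2 : ℂ) * z ^ (1 / 2 : ℂ) = z := by
  have h := Complex.cpow_nat_inv_pow z (n := 2) two_ne_zero
  rw [sq] at h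
  simpa using h

/-- The factor of `qSixJ q a b e c d f` which does not depend on `e` and is not a Racah sum. -/
def sixJFactor (q : ℂ) (a b c d f : ℕ) : ℂ :=
  qTriangle q a d f ^ (1 / 2 : ℂ) * qTriangle q c b f ^ (1 / 2 : ℂ)

theorem sixJFactor_mul_self (q : ℂ) (a b c d f : ℕ) :
    sixJFactor q a b c d f * sixJFactor q a b c d f = qTriangle q a d f * qTriangle q c b f := by
  rw [sixJFactor, mul_mul_mul_comm, cpow_half_mul_self, cpow_half_mul_self]

/-- The square roots depending on `e` occur twice and disappear. The others do not depend on `e`,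
and they square away when `g = f`, so the choice of branch plays no role. -/
theorem qSixJ_mul_qSixJ {q : ℂ} {a b c d e f g : ℕ} (h1 : QAdmissible q a b e)
    (h2 : QAdmissible q c d e) (hg : QAdmissible q a d g) (hg' : QAdmissible q c b g)
    (hf : QAdmissible q a d f) (hf' : QAdmissible q c b f) :
    qSixJ q a b e c d g * qSixJ q a b e c d f
      = sixJFactor q a b c d g * sixJFactor q a b c d f
        * (qTriangle q a b e * qTriangle q c d e * sixJSum q a b c d e g
          * sixJSum q a b c d e f) := by
  rw [qSixJ, if_pos ⟨h1, hg, hg', h2⟩, qSixJ, if_pos ⟨h1, hf, hf', h2⟩, qRacahSum_eq_sixJSum,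
    qRacahSum_eq_sixJSum, sixJFactor, sixJFactor]
  have e1 := cpow_half_mul_self (qTriangle q a b e)
  have e2 := cpow_half_mul_self (qTriangle q c d e)
  linear_combination (qTriangle q a d g ^ (1 / 2 : ℂ) * qTriangle q c b g ^ (1 / 2 : ℂ)
    * qTriangle q a d f ^ (1 / 2 : ℂ) * qTriangle q c b f ^ (1 / 2 : ℂ)
    * sixJSum q a b c d e g * sixJSum q a b c d e f)
    * (qTriangle q a b e ^ (1 / 2 : ℂ) * qTriangle q a b e ^ (1 / 2 : ℂ) * e2
      + qTriangle q c d e * e1)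

theorem sum_qCouplings_eq_racahPairing {q : ℂ} (hq : q ≠ 0) {a b c d f g : ℕ}
    (hg : QAdmissible q a d g) (hg' : QAdmissible q c b g)
    (hf : QAdmissible q a d f) (hf' : QAdmissible q c b f) :
    ∑ e ∈ qCouplings q a b, qInt q (e + 1) * (qSixJ q a b e c d g * qSixJ q a b e c d f)
      = sixJFactor q a b c d g * sixJFactor q a b c d f * racahPairing q a b c d g f := by
  classical
  have hE : commonCouplings q a b c d
      = ((qCouplings q a b).filter fun e => QAdmissible q c d e).image (fun e : ℕ => (e : ℤ)) := by
    ext e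
    simp only [mem_commonCouplings, Finset.mem_image, Finset.mem_filter, mem_qCouplings,
      qAdmissible_iff_qAdm hq]
    constructor
    · rintro ⟨h1, h2⟩
      have h3 := h1.2.1
      lift e to ℕ using by omega
      exact ⟨e, ⟨h1, h2⟩, rfl⟩
    · rintro ⟨e, he, rfl⟩
      exact he
  rw [racahPairing, hE, Finset.sum_image fun x _ y _ h => by simpa using h, Finset.mul_sum,
    Finset.sum_filter]
  refine Finset.sum_congr rfl fun e he => ?_
  rw [mem_qCouplings] at he
  split_ifs with h2
  · rw [qSixJ_mul_qSixJ he h2 hg hg' hf hf', ← ((qAdmissible_iff_qAdm hq _ _ _).mp he).qTriangle_eq,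
      ← ((qAdmissible_iff_qAdm hq _ _ _).mp h2).qTriangle_eq, ← qNum_natCast]
    push_cast
    ring
  · rw [qSixJ, if_neg fun h => h2 h.2.2.2]
    ring

open Classical in
/-- Orthogonality of the quantum `6j`-symbols. -/
theorem sum_qInt_mul_qSixJ_mul_qSixJ {q : ℂ} (hq : q ≠ 0) (a b c d g f : ℕ) :
    ∑ e ∈ qCouplings q a b, qInt q (e + 1) * (qSixJ q a b e c d g * qSixJ q a b e c d f)
      = if g = f ∧ QAdmissible q a d f ∧ QAdmissible q c b f then (qInt q (f + 1))⁻¹ else 0 := by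
  by_cases hf : QAdmissible q a d f ∧ QAdmissible q c b f
  · by_cases hg : QAdmissible q a d g ∧ QAdmissible q c b g
    · have pg := (qAdmissible_iff_qAdm hq _ _ _).mp hg.1
      have pg' := (qAdmissible_iff_qAdm hq _ _ _).mp hg.2
      have pf := (qAdmissible_iff_qAdm hq _ _ _).mp hf.1
      have pf' := (qAdmissible_iff_qAdm hq _ _ _).mp hf.2
      rw [sum_qCouplings_eq_racahPairing hq hg.1 hg.2 hf.1 hf.2,
        racahOrthogonal hq (by omega) (by omega) (by omega) (by omega) _ _ pg.1 pg'.1 pf.1 pf'.1,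
        racahNorm]
      by_cases h : g = f
      · subst h
        have n1 := pf.triangleCoeff_ne_zero
        have n2 := pf'.triangleCoeff_ne_zero
        rw [if_pos ⟨rfl, pf, pf'⟩, if_pos ⟨rfl, hf⟩, sixJFactor_mul_self, pf.qTriangle_eq,
          pf'.qTriangle_eq, ← qNum_natCast]
        push_cast
        rw [mul_assoc (qNum q _), mul_inv, mul_comm, mul_assoc,
          inv_mul_cancel₀ (mul_ne_zero n1 n2), mul_one]
      · rw [if_neg fun h' => h (by exact_mod_cast h'.1), if_neg fun h' => h h'.1, mul_zero]
    · rw [if_neg (by rintro ⟨rfl, h⟩; exact hg h)]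
      refine Finset.sum_eq_zero fun e _ => ?_
      rw [qSixJ_eq_zero hg]
      ring
  · rw [if_neg fun h => hf h.2]
    refine Finset.sum_eq_zero fun e _ => ?_
    rw [qSixJ_eq_zero hf]
    ring

end

/-! ### The sum over `μ` of toroidal symbols -/

theorem mainTheorem3 (A : ℂ) (hA : A ≠ 0)
    (j₁₁ j₁₂ j₂₁ j₂₂ j₂₃ j₃₁ j₃₂ j₃₃ l : ℕ) :
    ∑ μ ∈ qCouplings (A ^ 2) j₁₁ j₁₂,
        qInt (A ^ 2) (μ + 1)
          * toroidalSymbol A j₁₁ j₁₂ μ j₂₁ j₂₂ j₂₃ j₃₁ j₃₂ j₃₃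
          * qSixJ (A ^ 2) j₁₁ j₁₂ μ j₂₃ j₃₃ l
      = (-1) ^ l * twistFactor A j₂₁ j₃₂ l
          * qSixJ (A ^ 2) j₂₁ j₂₂ j₂₃ j₁₂ l j₃₂
          * qSixJ (A ^ 2) j₃₁ j₃₂ j₃₃ l j₁₁ j₂₁ := by
  classical
  have hq : A ^ 2 ≠ 0 := pow_ne_zero 2 hA
  set q := A ^ 2 with hqdef
  have s1 : ∀ μ x, qSixJ q μ j₂₃ j₃₃ x j₁₁ j₁₂ = qSixJ q j₁₁ j₁₂ μ j₂₃ j₃₃ x := fun μ x => by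
    rw [qSixJ_swap, qSixJ_swap_right, qSixJ_flip]
  have s2 : qSixJ q j₁₁ j₂₁ j₃₁ j₃₂ j₃₃ l = qSixJ q j₃₁ j₃₂ j₃₃ l j₁₁ j₂₁ := by
    rw [qSixJ_flip, qSixJ_swap_right, qSixJ_swap]
  have s3 : qSixJ q j₁₂ j₂₂ j₃₂ j₂₁ l j₂₃ = qSixJ q j₂₁ j₂₂ j₂₃ j₁₂ l j₃₂ := by
    rw [qSixJ_swap_right, qSixJ_flip, qSixJ_swap_right]
  have key : ∑ μ ∈ qCouplings q j₁₁ j₁₂,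
        qInt q (μ + 1) * toroidalSymbol A j₁₁ j₁₂ μ j₂₁ j₂₂ j₂₃ j₃₁ j₃₂ j₃₃
          * qSixJ q j₁₁ j₁₂ μ j₂₃ j₃₃ l
      = ∑ x ∈ qCouplings q j₁₁ j₃₃, loopValue q x * qSixJ q j₁₁ j₂₁ j₃₁ j₃₂ j₃₃ x
          * qSixJ q j₁₂ j₂₂ j₃₂ j₂₁ x j₂₃ * twistFactor A j₂₁ j₃₂ x
          * (if x = l ∧ QAdmissible q j₁₁ j₃₃ l ∧ QAdmissible q j₂₃ j₁₂ l
              then (qInt q (l + 1))⁻¹ else 0) := by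
    simp only [toroidalSymbol, ← hqdef, ← sum_qInt_mul_qSixJ_mul_qSixJ hq, Finset.mul_sum,
      Finset.sum_mul]
    rw [Finset.sum_comm]
    refine Finset.sum_congr rfl fun x _ => Finset.sum_congr rfl fun μ _ => ?_
    rw [s1]
    ring
  rw [key, ← s2, ← s3]
  -- For admissible `l` only `x = l` survives and `[l+1]` cancels. Otherwise the left side is zero,
  -- and the failing triple also occurs in one of the symbols on the right.
  by_cases hl : QAdmissible q j₁₁ j₃₃ l ∧ QAdmissible q j₂₃ j₁₂ l
  · have hl' := (qAdmissible_iff_qAdm hq _ _ _).mp hl.1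
    have hn : qInt q (l + 1) ≠ 0 := by
      have h1 := hl'.2.1
      have h2 := hl'.qNum_ne_zero (n := (l + 1 : ℕ)) (by omega) (by omega)
      rwa [qNum_natCast] at h2
    rw [Finset.sum_eq_single_of_mem l ((mem_qCouplings _ _ _ _).mpr hl.1)
      fun x _ hx => by rw [if_neg fun h => hx h.1, mul_zero], if_pos ⟨rfl, hl⟩, loopValue]
    field_simp
  · rw [Finset.sum_eq_zero fun x _ => by rw [if_neg fun h => hl h.2, mul_zero]]
    by_cases h1 : QAdmissible q j₁₁ j₃₃ l
    · have h2 : qSixJ q j₁₂ j₂₂ j₃₂ j₂₁ l j₂₃ = 0 :=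
        qSixJ_eq_zero fun h => hl ⟨h1, h.1.swap_right.swap⟩
      rw [h2]
      ring
    · have h2 : qSixJ q j₁₁ j₂₁ j₃₁ j₃₂ j₃₃ l = 0 := qSixJ_eq_zero fun h => h1 h.1
      rw [h2]
      ring
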